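/- Conventions: the stronger condition is the greater one; $[X]^{n}$ and $[X]^{<\lambda}$ are the families of subsets of $X$ of size $n$, respectively less than $\lambda$; $\sup\emptyset=0$; a function $f:w\to 2$ is extended to Boolean terms in the variables $x_i$ ($i\in w$) in the usual way; for a Boolean term $\tau=\tau(y_1,\dots,y_n)$ and an $n$-element set $v=\{i_1<\dots<i_n\}$ of ordinals, $\tau(x_i:i\in v)=\tau(x_{i_1},\dots,x_{i_n})$; $\sigma_{\rm maj}(y_0,y_1,y_2)=(y_0\wedge y_1)\vee(y_0\wedge y_2)\vee(y_1\wedge y_2)$. **The forcing notion $\mathbb P^\theta_\lambda$.** Let $\theta<\lambda$ be infinite regular cardinals. By induction on $\alpha<\lambda$ we define sets $P_\alpha$ of conditions, relations $\le^\alpha_{\rm pr}$ and $\le^\alpha$ on $P_\alpha$, and for each condition $p$ a set $u^p\subseteq\lambda^+$, a family $F^p\subseteq 2^{u^p}$, a height ${\rm ht}(p)$, and functions $h^p,g^p$ with domain $u^p\times{\rm ht}(p)$. Tuples introduced in different clauses below are regarded as distinct objects. *Stage $0$.* $P_0=\{\langle\xi\rangle:\xi<\lambda^+\}$; for $p=\langle\xi\rangle$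 we put $u^p=\{\xi\}$, $F^p=2^{\{\xi\}}$, ${\rm ht}(p)=0$, $h^p=g^p=\emptyset$. Both relations $\le^0_{\rm pr},\le^0$ are equality. *Limit $\gamma<\lambda$.* $P^*_\gamma$ is the set of sequences $\langle p_\xi:\xi<\gamma\rangle$ such that for all $\xi<\zeta<\gamma$: $p_\xi\in P_\xi$, ${\rm ht}(p_\xi)=\xi$ and $p_\xi\le^\zeta_{\rm pr}p_\zeta$; and $P_\gamma=\bigcup_{\alpha<\gamma}P_\alpha\cup P^*_\gamma$. For $p\in P^*_\gamma$: $u^p=\bigcup_\xi u^{p_\xi}$, $F^p=\{f\in2^{u^p}:(\forall\xi<\gamma)\,f\restriction u^{p_\xi}\in F^{p_\xi}\}$, ${\rm ht}(p)=\gamma$, $h^p=\bigcup_\xi h^{p_\xi}$, $g^p=\bigcup_\xi g^{p_\xi}$. Moreover - $p\le^\gamma_{\rm pr}q$ iff $p\le^\alpha_{\rm pr}q$ with $p,q\in P_\alpha$ for some $\alpha<\gamma$; or $q=\langle q_\xi:\xi<\gamma\rangle\in P^*_\gamma$ and $p\in P_\alpha$, $p\le^\alpha_{\rm pr}q_\alpha$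 for some $\alpha<\gamma$; or $p=q$; - $p\le^\gamma q$ iff $p\le^\alpha q$ with $p,q\in P_\alpha$ for some $\alpha<\gamma$; or $q=\langle q_\xi:\xi<\gamma\rangle\in P^*_\gamma$ and $p\in P_\alpha$, $p\le^\alpha q_\alpha$ for some $\alpha<\gamma$; or $p=\langle p_\xi:\xi<\gamma\rangle$ and $q=\langle q_\xi:\xi<\gamma\rangle$ are in $P^*_\gamma$ and $(\exists\delta<\gamma)(\forall\xi\in[\delta,\gamma))\;p_\xi\le^\xi q_\xi$. *Successor $\alpha+1<\lambda$.* $P^*_{\alpha+1}$ is the set of tuples $\langle\zeta^*,\tau^*,n^*,u^*,\langle p_\xi,v_\xi:\xi<\theta\rangle\rangle$ such that - $(\alpha)$ $\zeta^*<\theta$, $n^*<\omega$, $\tau^*=\tau^*(y_1,\dots,y_{n^*})$ is a Boolean term, $u^*\in[\lambda^+]^{<\lambda}$; - $(\beta)$ for every $\xi<\theta$: $p_\xi\in P_\alpha$, ${\rm ht}(p_\xi)=\alpha$, $v_\xi\in[u^{p_\xi}]^{n^*}$; - $(\gamma)$ for all $\xi_0<\xi_1<\theta$: $u^{p_{\xi_0}}\cap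 u^{p_{\xi_1}}=u^*$, $u^{p_{\xi_0}}\setminus u^*\ne\emptyset$ and $\sup(u^*)<\min(u^{p_{\xi_0}}\setminus u^*)\le\sup(u^{p_{\xi_0}}\setminus u^*)<\min(u^{p_{\xi_1}}\setminus u^*)$; - $(\delta)$ for all $\xi_0<\xi_1<\theta$ there is an order isomorphism $H:u^{p_{\xi_0}}\to u^{p_{\xi_1}}$, and it satisfies: $H\restriction u^*$ is the identity, $F^{p_{\xi_0}}=\{f\circ H:f\in F^{p_{\xi_1}}\}$, $H[v_{\xi_0}]=v_{\xi_1}$, and $h^{p_{\xi_0}}(j,\beta)=h^{p_{\xi_1}}(H(j),\beta)$, $g^{p_{\xi_0}}(j,\beta)=g^{p_{\xi_1}}(H(j),\beta)$ for all $j\in u^{p_{\xi_0}}$, $\beta<\alpha$. $P_{\alpha+1}=P_\alpha\cup P^*_{\alpha+1}$. For such a tuple $p\in P^*_{\alpha+1}$ put $u^p=\bigcup_{\xi<\theta}u^{p_\xi}$, ${\rm ht}(p)=\alpha+1$, $\tau_\xi=\tau^*(x_i:i\in v_\xi)$, and let $F^p$ be the set of all $f\in2^{u^p}$ such that $f\restriction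 u^{p_\xi}\in F^{p_\xi}$ for all $\xi<\theta$ and $$f(\sigma_{\rm maj}(\tau_{3\cdot\xi},\tau_{3\cdot\xi+1},\tau_{3\cdot\xi+2}))\le f(\sigma_{\rm maj}(\tau_{3\cdot\zeta},\tau_{3\cdot\zeta+1},\tau_{3\cdot\zeta+2}))\quad\text{for all }\xi<\zeta<\theta.$$ For $\beta<\alpha$ and $j\in u^{p_\xi}$ let $h^p(j,\beta)=h^{p_\xi}(j,\beta)$ and $g^p(j,\beta)=g^{p_\xi}(j,\beta)$. Let $h^p(j,\alpha)$ be $\theta$ if $j\in u^*$, $\theta+1$ if $j\in u^{p_{\zeta^*}}\setminus u^*$, and $\xi$ if $j\in u^{p_\xi}\setminus u^*$ with $\xi\neq\zeta^*$. Let $g^p(j,\alpha)$ be $(1,\tau^*)$ if $j\in v_\xi$ and $(0,\tau^*)$ if $j\in u^{p_\xi}\setminus v_\xi$. Moreover - $p\le^{\alpha+1}_{\rm pr}q$ iff $p,q\in P_\alpha$ and $p\le^\alpha_{\rm pr}q$; or $q=\langle\zeta^*,\tau^*,n^*,u^*,\langle q_\xi,v_\xi:\xi<\theta\rangle\rangle\in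 P^*_{\alpha+1}$, $p\in P_\alpha$ and $p\le^\alpha_{\rm pr}q_{\zeta^*}$; or $p=q$; - $p\le^{\alpha+1}q$ iff $p,q\in P_\alpha$ and $p\le^\alpha q$; or $q=\langle\zeta^*,\tau^*,n^*,u^*,\langle q_\xi,v_\xi:\xi<\theta\rangle\rangle\in P^*_{\alpha+1}$, $p\in P_\alpha$ and $p\le^\alpha q_\xi$ for some $\xi<\theta$; or $p=\langle\zeta^{**},\tau^*,n^*,u^*,\langle p_\xi,v_\xi:\xi<\theta\rangle\rangle$ and $q=\langle\zeta^*,\tau^*,n^*,u^*,\langle q_\xi,v_\xi:\xi<\theta\rangle\rangle$ are in $P^*_{\alpha+1}$ (with the same $\tau^*,n^*,u^*,v_\xi$) and $p_\xi\le^\alpha q_\xi$, $u^{p_\xi}=u^{q_\xi}$ for all $\xi<\theta$. Finally $\mathbb P^\theta_\lambda=\bigcup_{\alpha<\lambda}P_\alpha$ and ${\le}=\bigcup_{\alpha<\lambda}{\le^\alpha}$, which is a transitive and reflexive relation. **Properties.** A subset $D$ of a forcing notion $\mathbb Q$ is open dense if it is closed under stronger conditions and every condition has a stronger one in $D$. $\mathbb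 Q$ is $({<}\lambda)$-strategically closed if the second player has a winning strategy in the following game of length $\lambda$: the first player starts by choosing $p^*\in\mathbb Q$; in the $i$-th move ($i<\lambda$) the first player chooses an open dense set $D_i\subseteq\mathbb Q$, and then the second player picks $p_i\in D_i$ with $p_i\ge p_j$ for all $j<i$, and with $p_0\ge p^*$. The second player loses if for some $i<\lambda$ he has no legal move. $\mathbb Q$ is $\lambda^+$-cc if every set of pairwise incompatible conditions (no two of them having a common stronger condition) has cardinality less than $\lambda^+$. **Proposition 3.3.** Assume that $\theta<\lambda$ are infinite regular cardinals and $\lambda^{<\lambda}=\lambda$. Then $(\mathbb P^\theta_\lambda,\le)$ is $({<}\lambda)$-strategically closed and $\lambda^+$-cc. -/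

import Mathlib

universe u v

namespace Historic

/-! ### Boolean terms -/

/-- Boolean terms `τ(y₀, …, yₙ₋₁)`. -/
inductive BoolTerm (n : ℕ) : Type where
  | var (k : Fin n) : BoolTerm n
  | bot : BoolTerm n
  | top : BoolTerm n
  | neg (t : BoolTerm n) : BoolTerm n
  | inf (s t : BoolTerm n) : BoolTerm n
  | sup (s t : BoolTerm n) : BoolTerm n

/-- The value of a Boolean term in `{0, 1}` under an assignment of the variables. -/
def BoolTerm.eval {n : ℕ} (e : Fin n → Bool) : BoolTerm n → Bool
  | var k => e k
  | bot => false
  | top => true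
  | neg t => !(t.eval e)
  | inf s t => s.eval e && t.eval e
  | sup s t => s.eval e || t.eval e

/-- The majority term `(y₀ ∧ y₁) ∨ (y₀ ∧ y₂) ∨ (y₁ ∧ y₂)`, evaluated in `{0, 1}`. -/
def maj (a b c : Bool) : Bool := (a && b) || (a && c) || (b && c)

/-! ### Raw conditions -/

/-- Raw conditions: the tuples out of which the forcing conditions are selected by `IsCond` below.

* `base ξ` is the sequence `⟨ξ⟩`.
* `succ α ζ n τ w p v` is the tuple `⟨ζ, τ, n, w, ⟨p_ξ, v_ξ : ξ < θ⟩⟩`, of height `α + 1`; the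
  `n`-element set `v_ξ` of ordinals is given by its increasing enumeration, and the common height
  `α` of the `p_ξ` is recorded as well.
* `lim γ p` is the sequence `⟨p_ξ : ξ < γ⟩`, of height `γ`. -/
inductive PreCond (θ : Cardinal.{u}) : Type (u + 1) where
  | base (ξ : Ordinal.{u}) : PreCond θ
  | succ (α : Ordinal.{u}) (ζ : Set.Iio θ.ord) (n : ℕ) (τ : BoolTerm n) (w : Set Ordinal.{u})
      (p : Set.Iio θ.ord → PreCond θ) (v : Set.Iio θ.ord → (Fin n ↪o Ordinal.{u})) : PreCond θ
  | lim (γ : Ordinal.{u}) (p : Set.Iio γ → PreCond θ) : PreCond θ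

namespace PreCond

variable {θ : Cardinal.{u}}

/-- The height `ht(p)`. -/
def ht : PreCond θ → Ordinal.{u}
  | base _ => 0
  | succ α _ _ _ _ _ _ => α + 1
  | lim γ _ => γ

/-- The set of ordinals `u^p`. -/
def supp : PreCond θ → Set Ordinal.{u}
  | base ξ => {ξ}
  | succ _ _ _ _ _ p _ => ⋃ ξ, (p ξ).supp
  | lim _ p => ⋃ ξ, (p ξ).supp

/-- The value `f(τ(x_i : i ∈ v_ξ))`. (The second case does not occur for infinite `θ` and the
ordinals `ξ < θ` for which this is used.) -/
noncomputable def termVal {n : ℕ} (τ : BoolTerm n) (v : Set.Iio θ.ord → (Fin n ↪o Ordinal.{u}))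
    (f : Ordinal.{u} → Bool) (ξ : Ordinal.{u}) : Bool :=
  open scoped Classical in
  if h : ξ < θ.ord then τ.eval (fun k => f (v ⟨ξ, h⟩ k)) else false

/-- `Sat p f` says that the restriction of `f` to `u^p` is in `F^p`. -/
def Sat : PreCond θ → (Ordinal.{u} → Bool) → Prop
  | base _, _ => True
  | succ _ _ _ τ _ p v, f =>
      (∀ ξ, (p ξ).Sat f) ∧
      ∀ ξ ζ : Ordinal.{u}, ξ < ζ → ζ < θ.ord →
        maj (termVal τ v f (3 * ξ)) (termVal τ v f (3 * ξ + 1)) (termVal τ v f (3 * ξ + 2)) ≤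
        maj (termVal τ v f (3 * ζ)) (termVal τ v f (3 * ζ + 1)) (termVal τ v f (3 * ζ + 2))
  | lim _ p, f => ∀ ξ, (p ξ).Sat f

/-- The family `F^p ⊆ 2^{u^p}`. -/
def F (p : PreCond θ) : Set (p.supp → Bool) :=
  {f | ∃ f' : Ordinal.{u} → Bool, p.Sat f' ∧ ∀ i : p.supp, f i = f' i}

/-- The graph of the function `h^p : u^p × ht(p) → θ + 2`: `Hist p j β y` says that
`h^p(j, β) = y`. -/
def Hist : PreCond θ → Ordinal.{u} → Ordinal.{u} → Ordinal.{u} → Prop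
  | base _, _, _, _ => False
  | succ α ζ _ _ w p _, j, β, y =>
      (β < α ∧ ∃ ξ, j ∈ (p ξ).supp ∧ (p ξ).Hist j β y) ∨
      (β = α ∧ j ∈ w ∧ y = θ.ord) ∨
      (β = α ∧ j ∈ (p ζ).supp \ w ∧ y = θ.ord + 1) ∨
      (β = α ∧ ∃ ξ, ξ ≠ ζ ∧ j ∈ (p ξ).supp \ w ∧ y = (ξ : Ordinal.{u}))
  | lim _ p, j, β, y => ∃ ξ, (p ξ).Hist j β y

/-- The graph of the function `g^p` on `u^p × ht(p)`: `Gist p j β ℓ τ` says that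
`g^p(j, β) = (ℓ, τ)`. -/
def Gist : PreCond θ → Ordinal.{u} → Ordinal.{u} → Bool → (Σ n, BoolTerm n) → Prop
  | base _, _, _, _, _ => False
  | succ α _ n τ _ p v, j, β, l, t =>
      (β < α ∧ ∃ ξ, j ∈ (p ξ).supp ∧ (p ξ).Gist j β l t) ∨
      (β = α ∧ l = true ∧ t = ⟨n, τ⟩ ∧ ∃ ξ, j ∈ Set.range (v ξ)) ∨
      (β = α ∧ l = false ∧ t = ⟨n, τ⟩ ∧ ∃ ξ, j ∈ (p ξ).supp \ Set.range (v ξ))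
  | lim _ p, j, β, l, t => ∃ ξ, (p ξ).Gist j β l t

/-! ### The pure order and the main order -/

/-- The pure order `p ≤_pr q`. -/
inductive LePr : PreCond θ → PreCond θ → Prop where
  | refl (p : PreCond θ) : LePr p p
  | succ {p : PreCond θ} {α : Ordinal.{u}} {ζ : Set.Iio θ.ord} {n : ℕ} {τ : BoolTerm n}
      {w : Set Ordinal.{u}} {q : Set.Iio θ.ord → PreCond θ}
      {v : Set.Iio θ.ord → (Fin n ↪o Ordinal.{u})} :
      LePr p (q ζ) → LePr p (succ α ζ n τ w q v)
  | lim {p : PreCond θ} {γ : Ordinal.{u}} {q : Set.Iio γ → PreCond θ} (ξ : Set.Iio γ) :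
      LePr p (q ξ) → LePr p (lim γ q)

/-- The main order `p ≤ q` (the stronger condition is the greater one). -/
inductive Le : PreCond θ → PreCond θ → Prop where
  | base (ξ : Ordinal.{u}) : Le (base ξ) (base ξ)
  | succ {p : PreCond θ} {α : Ordinal.{u}} {ζ : Set.Iio θ.ord} {n : ℕ} {τ : BoolTerm n}
      {w : Set Ordinal.{u}} {q : Set.Iio θ.ord → PreCond θ}
      {v : Set.Iio θ.ord → (Fin n ↪o Ordinal.{u})} (ξ : Set.Iio θ.ord) :
      Le p (q ξ) → Le p (succ α ζ n τ w q v)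
  | succ_succ {α : Ordinal.{u}} {ζ ζ' : Set.Iio θ.ord} {n : ℕ} {τ : BoolTerm n}
      {w : Set Ordinal.{u}} {p q : Set.Iio θ.ord → PreCond θ}
      {v : Set.Iio θ.ord → (Fin n ↪o Ordinal.{u})} :
      (∀ ξ, Le (p ξ) (q ξ)) → (∀ ξ, (p ξ).supp = (q ξ).supp) →
      Le (succ α ζ' n τ w p v) (succ α ζ n τ w q v)
  | lim {p : PreCond θ} {γ : Ordinal.{u}} {q : Set.Iio γ → PreCond θ} (ξ : Set.Iio γ) :
      Le p (q ξ) → Le p (lim γ q)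
  | lim_lim {γ : Ordinal.{u}} {p q : Set.Iio γ → PreCond θ} (δ : Set.Iio γ) :
      (∀ ξ, δ ≤ ξ → Le (p ξ) (q ξ)) → Le (lim γ p) (lim γ q)

/-! ### Conditions -/

/-- The raw condition `p` is a condition, i.e. belongs to `P_α` for some `α < κ`. -/
def IsCond (κ : Cardinal.{u}) : PreCond θ → Prop
  | base ξ => ξ < (Order.succ κ).ord
  | succ α _ _ _ w p v =>
      α < κ.ord ∧
      w ⊆ Set.Iio (Order.succ κ).ord ∧ Cardinal.mk w < Cardinal.lift.{u + 1} κ ∧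
      (∀ ξ, (p ξ).IsCond κ ∧ (p ξ).ht = α ∧ Set.range (v ξ) ⊆ (p ξ).supp ∧
        ((p ξ).supp \ w).Nonempty ∧ sSup w < sInf ((p ξ).supp \ w)) ∧
      ∀ ξ₀ ξ₁, ξ₀ < ξ₁ →
        (p ξ₀).supp ∩ (p ξ₁).supp = w ∧
        sSup ((p ξ₀).supp \ w) < sInf ((p ξ₁).supp \ w) ∧
        ∃ H : (p ξ₀).supp ≃o (p ξ₁).supp,
          (∀ j : (p ξ₀).supp, (j : Ordinal.{u}) ∈ w → (H j : Ordinal.{u}) = j) ∧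
          (p ξ₀).F = {f | ∃ f' ∈ (p ξ₁).F, f = f' ∘ H} ∧
          (∀ j : (p ξ₀).supp,
            (j : Ordinal.{u}) ∈ Set.range (v ξ₀) ↔ (H j : Ordinal.{u}) ∈ Set.range (v ξ₁)) ∧
          ∀ j : (p ξ₀).supp, ∀ β < α,
            (∀ y, (p ξ₀).Hist j β y ↔ (p ξ₁).Hist (H j) β y) ∧
            (∀ l t, (p ξ₀).Gist j β l t ↔ (p ξ₁).Gist (H j) β l t)
  | lim γ p =>
      γ < κ.ord ∧ Order.IsSuccLimit γ ∧
      (∀ ξ, (p ξ).IsCond κ ∧ (p ξ).ht = (ξ : Ordinal.{u})) ∧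
      ∀ ξ₀ ξ₁, ξ₀ < ξ₁ → LePr (p ξ₀) (p ξ₁)

theorem Le.refl {κ : Cardinal.{u}} (p : PreCond θ) (hp : p.IsCond κ) : Le p p := by
  induction p with
  | base ξ => exact .base ξ
  | succ α ζ n τ w p v ih =>
    exact .succ_succ (fun ξ => ih ξ (hp.2.2.2.1 ξ).1) fun _ => rfl
  | lim γ p ih =>
    obtain ⟨_, hγ, hc, _⟩ := hp
    exact .lim_lim ⟨0, hγ.bot_lt⟩ fun ξ _ => ih ξ (hc ξ).1

theorem LePr.le {κ : Cardinal.{u}} {p q : PreCond θ} (h : LePr p q) (hq : q.IsCond κ) :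
    Le p q := by
  induction h with
  | refl => exact Le.refl _ hq
  | succ _ ih => exact .succ _ (ih (hq.2.2.2.1 _).1)
  | lim ξ _ ih => exact .lim ξ (ih (hq.2.2.1 ξ).1)

theorem Le.trans {κ : Cardinal.{u}} {p q r : PreCond θ} (hq : q.IsCond κ) (hr : r.IsCond κ)
    (hpq : Le p q) (hqr : Le q r) : Le p r := by
  induction r generalizing p q with
  | base ξ => cases hqr; exact hpq
  | succ α ζ n τ w r v ih =>
    cases hqr with
    | succ ξ h => exact .succ ξ (ih ξ hq (hr.2.2.2.1 ξ).1 hpq h)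
    | succ_succ h hs =>
      cases hpq with
      | succ ξ h' => exact .succ ξ (ih ξ (hq.2.2.2.1 ξ).1 (hr.2.2.2.1 ξ).1 h' (h ξ))
      | succ_succ h' hs' =>
        exact .succ_succ
          (fun ξ => ih ξ (hq.2.2.2.1 ξ).1 (hr.2.2.2.1 ξ).1 (h' ξ) (h ξ))
          fun ξ => (hs' ξ).trans (hs ξ)
  | lim γ r ih =>
    cases hqr with
    | lim ξ h => exact .lim ξ (ih ξ hq (hr.2.2.1 ξ).1 hpq h)
    | @lim_lim _ q _ δ h =>
      obtain ⟨_, _, hqc, hqp⟩ := hq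
      have hrc := hr.2.2.1
      cases hpq with
      | lim ξ h' =>
        have key : Le (q ξ) (q (max ξ δ)) := by
          rcases (le_max_left ξ δ).eq_or_lt with e | e
          · rw [← e]; exact Le.refl _ (hqc ξ).1
          · exact (hqp _ _ e).le (hqc _).1
        refine .lim (max ξ δ) (ih _ (hqc ξ).1 (hrc _).1 h' ?_)
        exact ih _ (hqc _).1 (hrc _).1 key (h _ (le_max_right _ _))
      | lim_lim δ' h' =>
        refine .lim_lim (max δ δ') fun ξ hξ => ?_
        exact ih ξ (hqc ξ).1 (hrc ξ).1 (h' ξ ((le_max_right _ _).trans hξ))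
          (h ξ ((le_max_left _ _).trans hξ))

end PreCond

/-- The set of conditions of the historic forcing notion for the cardinals `θ` and `κ`. -/
def Forcing (θ κ : Cardinal.{u}) : Type (u + 1) := {p : PreCond θ // p.IsCond κ}

/-- The historic forcing notion, ordered by the main order. -/
instance (θ κ : Cardinal.{u}) : Preorder (Forcing θ κ) where
  le p q := PreCond.Le p.1 q.1
  le_refl p := PreCond.Le.refl p.1 p.2
  le_trans _ q r hpq hqr := PreCond.Le.trans q.2 r.2 hpq hqr

/-! ### Properties of forcing notions (the stronger condition is the greater one) -/

/-- Open dense subsets of a forcing notion. -/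
structure OpenDense (Q : Type v) [Preorder Q] where
  carrier : Set Q
  isOpen : ∀ p ∈ carrier, ∀ q, p ≤ q → q ∈ carrier
  dense : ∀ p, ∃ q ∈ carrier, p ≤ q

/-- The second player has a winning strategy in the game of length `κ` in which the first player
opens with a condition `s`; in the `i`-th round the first player plays an open dense set `D i`, and
then the second player has to play a condition `p i ∈ D i` with `p i ≥ p j` for all `j < i`, and
with `p 0 ≥ s`. The second player loses when he cannot move.

A strategy `σ` answers the position consisting of `s`, `i`, the sets `D j` for `j ≤ i`, and the
conditions `p j` for `j < i`. It is winning if in every play in which the second player follows it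
all his moves are legal. -/
def StrategicallyClosed (Q : Type v) [Preorder Q] (κ : Cardinal.{u}) : Prop :=
  ∃ σ : Q → (i : Ordinal.{u}) → (Set.Iic i → OpenDense Q) → (Set.Iio i → Q) → Q,
    ∀ (s : Q) (D : Ordinal.{u} → OpenDense Q) (p : Ordinal.{u} → Q),
      (∀ i < κ.ord, p i = σ s i (fun j => D j) (fun j => p j)) →
      ∀ i < κ.ord, (i = 0 → s ≤ p i) ∧ p i ∈ (D i).carrier ∧ ∀ j < i, p j ≤ p i

/-- The `κ`-chain condition: every set of pairwise incompatible conditions has cardinality less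
than `κ`. -/
def ChainCondition (Q : Type v) [Preorder Q] (κ : Cardinal.{v}) : Prop :=
  ∀ A : Set Q, (∀ p ∈ A, ∀ q ∈ A, p ≠ q → ¬∃ r, p ≤ r ∧ q ≤ r) → Cardinal.mk A < κ

end Historic

namespace Historic

namespace PreCond

open Set

variable {θ κ : Cardinal.{u}}

/-! ### Heights and pure predecessors -/

/-! Both halves rest on a rigidity fact, `eq_map_of_agree`: `h` records at each level which
component a point lies in, and `g` records the term and membership in the chosen finite sets. A
condition is therefore determined, up to relabelling its support, by its height, `h` and `g`. In
particular the components of a successor condition are copies of one another along increasing maps.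

Strategic closure. The pure predecessors of a condition form a chain with exactly one member of each
height up to its own. Hence a pure chain of length less than `κ` has a pure upper bound: either its
heights reach a maximum, and it is constant from there on, or the predecessors of all heights below
the supremum form a limit condition (`exists_lePr_of_chain`). Moreover, every `q` above `p` is
equivalent to some `q'` purely above `p` (`Le.exists_lePr`). To see this, move the distinguished
index to the component containing `p`, then replace that component by an equivalent one, propagating
the change by copying to the other components and upwards (`graft`). The second player keeps his
moves a pure chain: he bounds it purely, enters the open dense set, and passes to an equivalent
purely stronger condition, which openness keeps in the set.

Chain condition. As `κ ^< κ = κ`, among more than `κ` conditions more than `κ` share the height, the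
order type of the support, and the transferred `h` and `g`. By rigidity these differ only in their
supports. At the least position where the enumerations of the supports are unbounded in `κ⁺`, one
can fix the part below and choose `θ` many conditions recursively, each lying past all previous
supports outside the common root. Such a Δ-system is the family of components of a successor
condition, which bounds all its members (`exists_isCond_of_deltaSystem`). -/

theorem LePr.trans {p q r : PreCond θ} (hpq : LePr p q) (hqr : LePr q r) : LePr p r := by
  induction hqr with
  | refl => exact hpq
  | succ _ ih => exact .succ ih
  | lim ξ _ ih => exact .lim ξ ih

theorem LePr.isCond {p q : PreCond θ} (h : LePr p q) (hq : q.IsCond κ) : p.IsCond κ := by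
  induction h with
  | refl => exact hq
  | succ _ ih => exact ih (hq.2.2.2.1 _).1
  | lim ξ _ ih => exact ih (hq.2.2.1 ξ).1

theorem LePr.supp_subset {p q : PreCond θ} (h : LePr p q) : p.supp ⊆ q.supp := by
  induction h with
  | refl => exact subset_rfl
  | @succ _ ζ _ _ _ q _ _ ih => exact ih.trans (subset_iUnion (fun ξ => (q ξ).supp) ζ)
  | @lim _ q ξ _ ih => exact ih.trans (subset_iUnion (fun ξ => (q ξ).supp) ξ)

theorem LePr.ht_le {p q : PreCond θ} (h : LePr p q) (hq : q.IsCond κ) : p.ht ≤ q.ht := by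
  induction h with
  | refl => exact le_rfl
  | succ _ ih =>
    have h := hq.2.2.2.1
    exact ((ih (h _).1).trans_eq (h _).2.1).trans (Order.le_succ _)
  | lim ξ _ ih =>
    have h := hq.2.2.1 ξ
    exact ((ih h.1).trans_eq h.2).trans ξ.2.le

theorem Le.ht_le {p q : PreCond θ} (h : Le p q) (hp : p.IsCond κ) (hq : q.IsCond κ) :
    p.ht ≤ q.ht := by
  induction h with
  | base => exact le_rfl
  | succ ξ _ ih =>
    have h := hq.2.2.2.1
    exact ((ih hp (h _).1).trans_eq (h _).2.1).trans (Order.le_succ _)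
  | succ_succ => exact le_rfl
  | lim ξ _ ih =>
    have h := hq.2.2.1 ξ
    exact ((ih hp h.1).trans_eq h.2).trans ξ.2.le
  | lim_lim => exact le_rfl

theorem Le.supp_subset {p q : PreCond θ} (h : Le p q) (hp : p.IsCond κ) (hq : q.IsCond κ) :
    p.supp ⊆ q.supp := by
  induction h with
  | base => exact subset_rfl
  | @succ _ _ _ _ _ _ q _ ξ _ ih =>
    exact (ih hp (hq.2.2.2.1 _).1).trans (subset_iUnion (fun ξ => (q ξ).supp) ξ)
  | succ_succ _ hs => exact (iUnion_congr hs).subset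
  | @lim _ _ q ξ _ ih =>
    exact (ih hp (hq.2.2.1 ξ).1).trans (subset_iUnion (fun ξ => (q ξ).supp) ξ)
  | @lim_lim γ p q δ _ ih =>
    refine iUnion_subset fun ξ => ?_
    have h1 : (p ξ).supp ⊆ (p (max ξ δ)).supp := by
      rcases (le_max_left ξ δ).eq_or_lt with e | e
      · rw [← e]
      · exact (hp.2.2.2 _ _ e).supp_subset
    exact (h1.trans (ih _ (le_max_right _ _) (hp.2.2.1 _).1 (hq.2.2.1 _).1)).trans
      (subset_iUnion (fun ξ => (q ξ).supp) _)

theorem LePr.eq_of_ht {p q : PreCond θ} (h : LePr p q) (hq : q.IsCond κ) (e : q.ht ≤ p.ht) :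
    p = q := by
  cases h with
  | refl => rfl
  | succ h =>
    have h' := hq.2.2.2.1
    exact absurd (e.trans ((h.ht_le (h' _).1).trans_eq (h' _).2.1)) (not_le.2 (Order.lt_succ _))
  | lim ξ h =>
    have h' := hq.2.2.1 ξ
    exact absurd (e.trans ((h.ht_le h'.1).trans_eq h'.2)) (not_le.2 ξ.2)

/-- The components of a limit condition form a pure chain. -/
theorem IsCond.lePr_lim {γ : Ordinal.{u}} {q : Iio γ → PreCond θ} (hq : (lim γ q).IsCond κ)
    {ξ ζ : Iio γ} (h : ξ ≤ ζ) : LePr (q ξ) (q ζ) := by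
  rcases h.eq_or_lt with rfl | h
  · exact .refl _
  · exact hq.2.2.2 _ _ h

/-- Pure predecessors of a condition are linearly ordered by their heights. -/
theorem LePr.comparable {r s q : PreCond θ} (hr : LePr r q) (hs : LePr s q) (hq : q.IsCond κ)
    (h : r.ht ≤ s.ht) : LePr r s := by
  induction q with
  | base ξ => cases hs; exact hr
  | succ α ζ n τ w q v ih =>
    have hc := hq.2.2.2.1
    cases hs with
    | refl => exact hr
    | succ hs =>
      cases hr with
      | refl =>
        exact absurd (h.trans ((hs.ht_le (hc _).1).trans_eq (hc _).2.1))
          (not_le.2 (Order.lt_succ _))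
      | succ hr => exact ih _ hr hs (hc _).1
  | lim γ q ih =>
    have hc := hq.2.2.1
    cases hs with
    | refl => exact hr
    | lim ξ hs =>
      cases hr with
      | refl => exact absurd (h.trans ((hs.ht_le (hc _).1).trans_eq (hc _).2)) (not_le.2 ξ.2)
      | lim ζ hr =>
        exact ih (max ξ ζ) (hr.trans (hq.lePr_lim (le_max_right _ _)))
          (hs.trans (hq.lePr_lim (le_max_left _ _))) (hc _).1

/-- Descend through the distinguished component at successor levels; at a limit level the
predecessor of height `ξ` is the `ξ`-th coordinate. -/
theorem exists_lePr_ht {q : PreCond θ} (hq : q.IsCond κ) {ξ : Ordinal.{u}} (h : ξ ≤ q.ht) :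
    ∃ r, LePr r q ∧ r.ht = ξ := by
  induction q with
  | base ζ => exact ⟨_, .refl _, (nonpos_iff_eq_zero.1 h).symm⟩
  | succ α ζ n τ w q v ih =>
    rcases h.eq_or_lt with e | e
    · exact ⟨_, .refl _, e.symm⟩
    · have hc := hq.2.2.2.1 ζ
      obtain ⟨r, hr, e⟩ := ih ζ hc.1 ((Order.lt_succ_iff.1 e).trans_eq hc.2.1.symm)
      exact ⟨r, .succ hr, e⟩
  | lim γ q ih =>
    rcases h.eq_or_lt with e | e
    · exact ⟨_, .refl _, e.symm⟩
    · exact ⟨q ⟨ξ, e⟩, .lim ⟨ξ, e⟩ (.refl _), (hq.2.2.1 _).2⟩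

/-- The clauses `succ` and `lim` strictly raise the height, so between equal heights only the
componentwise clauses remain, and these are symmetric. -/
theorem Le.symm_of_ht {p q : PreCond θ} (h : Le p q) (hp : p.IsCond κ) (hq : q.IsCond κ)
    (e : q.ht ≤ p.ht) : Le q p := by
  induction h with
  | base ξ => exact .base ξ
  | succ ξ h _ =>
    have h' := hq.2.2.2.1
    exact absurd (e.trans ((h.ht_le hp (h' _).1).trans_eq (h' _).2.1))
      (not_le.2 (Order.lt_succ _))
  | succ_succ h hs ih =>
    have h1 := hp.2.2.2.1
    have h2 := hq.2.2.2.1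
    exact .succ_succ
      (fun ξ => ih ξ (h1 ξ).1 (h2 ξ).1 ((h2 ξ).2.1.trans (h1 ξ).2.1.symm).le)
      fun ξ => (hs ξ).symm
  | lim ξ h _ =>
    have h' := hq.2.2.1 ξ
    exact absurd (e.trans ((h.ht_le hp h'.1).trans_eq h'.2)) (not_le.2 ξ.2)
  | lim_lim δ h ih =>
    have h1 := hp.2.2.1
    have h2 := hq.2.2.1
    exact .lim_lim δ fun ξ hξ =>
      ih ξ hξ (h1 ξ).1 (h2 ξ).1 ((h2 ξ).2.trans (h1 ξ).2.symm).le

/-- Two conditions are equivalent if each of them is stronger than the other. -/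
def Equiv (p q : PreCond θ) : Prop := Le p q ∧ Le q p

theorem Equiv.refl {p : PreCond θ} (hp : p.IsCond κ) : Equiv p p :=
  ⟨Le.refl p hp, Le.refl p hp⟩

theorem Equiv.ht_eq {p q : PreCond θ} (h : Equiv p q) (hp : p.IsCond κ) (hq : q.IsCond κ) :
    p.ht = q.ht := (h.1.ht_le hp hq).antisymm (h.2.ht_le hq hp)

theorem Equiv.supp_eq {p q : PreCond θ} (h : Equiv p q) (hp : p.IsCond κ) (hq : q.IsCond κ) :
    p.supp = q.supp := (h.1.supp_subset hp hq).antisymm (h.2.supp_subset hq hp)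

/-! ### Supports -/

theorem exists_lt_Iio_ord (hθ : Cardinal.aleph0 ≤ θ) :
    ∃ a b : Iio θ.ord, a < b := by
  have h : Ordinal.omega0 ≤ θ.ord := by rwa [Cardinal.omega0_le_ord]
  exact ⟨⟨0, Ordinal.omega0_pos.trans_le h⟩, ⟨1, Ordinal.one_lt_omega0.trans_le h⟩,
    Subtype.mk_lt_mk.2 zero_lt_one⟩

section Succ

variable {α : Ordinal.{u}} {ζ : Iio θ.ord} {n : ℕ} {τ : BoolTerm n} {w : Set Ordinal.{u}}
  {p : Iio θ.ord → PreCond θ} {v : Iio θ.ord → (Fin n ↪o Ordinal.{u})}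

theorem IsCond.inter_eq (h : (succ α ζ n τ w p v).IsCond κ) {ξ ξ' : Iio θ.ord} (hξ : ξ ≠ ξ') :
    (p ξ).supp ∩ (p ξ').supp = w := by
  rcases hξ.lt_or_gt with hlt | hlt
  · exact (h.2.2.2.2 _ _ hlt).1
  · rw [inter_comm]; exact (h.2.2.2.2 _ _ hlt).1

theorem IsCond.root_subset (hθ : Cardinal.aleph0 ≤ θ) (h : (succ α ζ n τ w p v).IsCond κ)
    (ξ : Iio θ.ord) : w ⊆ (p ξ).supp := by
  obtain ⟨a, b, hab⟩ := exists_lt_Iio_ord hθ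
  by_cases e : ξ = a
  · subst e; rw [← h.inter_eq hab.ne]; exact inter_subset_left
  · rw [← h.inter_eq e]; exact inter_subset_left

theorem supp_subset_succ (ξ : Iio θ.ord) : (p ξ).supp ⊆ (succ α ζ n τ w p v).supp :=
  subset_iUnion (fun ξ => (p ξ).supp) ξ

theorem supp_subset_lim {γ : Ordinal.{u}} {p : Iio γ → PreCond θ} (ξ : Iio γ) :
    (p ξ).supp ⊆ (lim γ p).supp :=
  subset_iUnion (fun ξ => (p ξ).supp) ξ

end Succ

theorem IsCond.supp_subset {p : PreCond θ} (hp : p.IsCond κ) :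
    p.supp ⊆ Iio (Order.succ κ).ord := by
  induction p with
  | base ξ => exact singleton_subset_iff.2 hp
  | succ α ζ n τ w p v ih => exact iUnion_subset fun ξ => ih ξ (hp.2.2.2.1 ξ).1
  | lim γ p ih => exact iUnion_subset fun ξ => ih ξ (hp.2.2.1 ξ).1

theorem IsCond.ht_lt (hκ : Cardinal.aleph0 ≤ κ) {p : PreCond θ} (hp : p.IsCond κ) :
    p.ht < κ.ord := by
  cases p with
  | base ξ => exact Cardinal.ord_pos.2 (Cardinal.aleph0_pos.trans_le hκ)
  | succ α ζ n τ w p v => exact (Cardinal.isSuccLimit_ord hκ).succ_lt hp.1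
  | lim γ p => exact hp.1

theorem IsCond.supp_nonempty {p : PreCond θ} (hp : p.IsCond κ) :
    p.supp.Nonempty := by
  induction p with
  | base ξ => exact singleton_nonempty ξ
  | succ α ζ n τ w p v ih => exact (ih ζ (hp.2.2.2.1 ζ).1).mono (supp_subset_succ ζ)
  | lim γ p ih =>
    exact (ih ⟨0, hp.2.1.bot_lt⟩ (hp.2.2.1 _).1).mono (supp_subset_lim _)

/-! ### The functions `h^p` and `g^p` -/

/-- `Agree α p q i j` says that `h^p, g^p` at `i` agree with `h^q, g^q` at `j`, below `α`. -/
def Agree (α : Ordinal.{u}) (p q : PreCond θ) (i j : Ordinal.{u}) : Prop :=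
  ∀ β < α, (∀ y, p.Hist i β y ↔ q.Hist j β y) ∧ (∀ l t, p.Gist i β l t ↔ q.Gist j β l t)

theorem Agree.symm {α : Ordinal.{u}} {p q : PreCond θ} {i j : Ordinal.{u}}
    (h : Agree α p q i j) : Agree α q p j i :=
  fun β hβ => ⟨fun y => ((h β hβ).1 y).symm, fun l t => ((h β hβ).2 l t).symm⟩

theorem Agree.trans {α : Ordinal.{u}} {p q r : PreCond θ} {i j k : Ordinal.{u}}
    (h : Agree α p q i j) (h' : Agree α q r j k) : Agree α p r i k :=
  fun β hβ => ⟨fun y => ((h β hβ).1 y).trans ((h' β hβ).1 y),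
    fun l t => ((h β hβ).2 l t).trans ((h' β hβ).2 l t)⟩

theorem Agree.refl (α : Ordinal.{u}) (p : PreCond θ) (i : Ordinal.{u}) : Agree α p p i i :=
  fun _ _ => ⟨fun _ => Iff.rfl, fun _ _ => Iff.rfl⟩

theorem Agree.mono {α β : Ordinal.{u}} {p q : PreCond θ} {i j : Ordinal.{u}}
    (h : Agree α p q i j) (hβ : β ≤ α) : Agree β p q i j :=
  fun γ hγ => h γ (hγ.trans_le hβ)

theorem Hist.mem (hθ : Cardinal.aleph0 ≤ θ) {p : PreCond θ} (hp : p.IsCond κ)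
    {j β y : Ordinal.{u}} (h : p.Hist j β y) :
    j ∈ p.supp ∧ β < p.ht ∧ y < θ.ord + 2 := by
  have h1 : θ.ord < θ.ord + 2 := (lt_add_iff_pos_right _).2 two_pos
  have h2 : θ.ord + 1 < θ.ord + 2 := (add_lt_add_iff_left _).2 one_lt_two
  induction p with
  | base ξ => exact h.elim
  | succ α ζ n τ w p v ih =>
    have hα : α < (succ α ζ n τ w p v).ht := Order.lt_succ α
    obtain ⟨hβ, ξ, hj, h⟩ | ⟨rfl, hj, rfl⟩ | ⟨rfl, hj, rfl⟩ | ⟨rfl, ξ, -, hj, rfl⟩ := h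
    · exact ⟨supp_subset_succ ξ hj, hβ.trans hα, (ih ξ (hp.2.2.2.1 ξ).1 h).2.2⟩
    · exact ⟨supp_subset_succ ζ (hp.root_subset hθ ζ hj), hα, h1⟩
    · exact ⟨supp_subset_succ ζ hj.1, hα, h2⟩
    · exact ⟨supp_subset_succ ξ hj.1, hα, (mem_Iio.1 ξ.2).trans h1⟩
  | lim γ p ih =>
    obtain ⟨ξ, h⟩ := h
    obtain ⟨h3, h4, h5⟩ := ih ξ (hp.2.2.1 ξ).1 h
    rw [(hp.2.2.1 ξ).2] at h4
    exact ⟨supp_subset_lim ξ h3, h4.trans ξ.2, h5⟩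

theorem Gist.mem {p : PreCond θ} (hp : p.IsCond κ) {j β : Ordinal.{u}} {l : Bool}
    {t : Σ n, BoolTerm n} (h : p.Gist j β l t) : j ∈ p.supp ∧ β < p.ht := by
  induction p with
  | base ξ => exact h.elim
  | succ α ζ n τ w p v ih =>
    have hα : α < (succ α ζ n τ w p v).ht := Order.lt_succ α
    obtain ⟨hβ, ξ, hj, h⟩ | ⟨rfl, -, -, ξ, hj⟩ | ⟨rfl, -, -, ξ, hj⟩ := h
    · exact ⟨supp_subset_succ ξ hj, hβ.trans hα⟩
    · exact ⟨supp_subset_succ ξ ((hp.2.2.2.1 ξ).2.2.1 hj), hα⟩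
    · exact ⟨supp_subset_succ ξ hj.1, hα⟩
  | lim γ p ih =>
    obtain ⟨ξ, h⟩ := h
    obtain ⟨h3, h4⟩ := ih ξ (hp.2.2.1 ξ).1 h
    rw [(hp.2.2.1 ξ).2] at h4
    exact ⟨supp_subset_lim ξ h3, h4.trans ξ.2⟩

section Succ

variable {α : Ordinal.{u}} {ζ : Iio θ.ord} {n : ℕ} {τ : BoolTerm n} {w : Set Ordinal.{u}}
  {p : Iio θ.ord → PreCond θ} {v : Iio θ.ord → (Fin n ↪o Ordinal.{u})}

/-- A point common to two different components lies in the root, which the isomorphism between them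
fixes. -/
theorem IsCond.agree_components (h : (succ α ζ n τ w p v).IsCond κ) {ξ ξ' : Iio θ.ord}
    {j : Ordinal.{u}} (hj : j ∈ (p ξ).supp) (hj' : j ∈ (p ξ').supp) :
    Agree α (p ξ) (p ξ') j j ∧ (j ∈ range (v ξ) ↔ j ∈ range (v ξ')) := by
  have key : ∀ ξ ξ' : Iio θ.ord, ξ < ξ' → j ∈ (p ξ).supp → j ∈ (p ξ').supp →
      Agree α (p ξ) (p ξ') j j ∧ (j ∈ range (v ξ) ↔ j ∈ range (v ξ')) := by
    intro ξ ξ' hlt hj hj'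
    obtain ⟨hi, _, H, hw, -, hv, hH⟩ := h.2.2.2.2 ξ ξ' hlt
    have e : (H ⟨j, hj⟩ : Ordinal.{u}) = j := hw ⟨j, hj⟩ (hi ▸ ⟨hj, hj'⟩)
    have h1 := hv ⟨j, hj⟩
    have h2 := hH ⟨j, hj⟩
    simp only [e] at h1 h2
    exact ⟨h2, h1⟩
  rcases lt_trichotomy ξ ξ' with hlt | rfl | hlt
  · exact key _ _ hlt hj hj'
  · exact ⟨.refl _ _ _, Iff.rfl⟩
  · obtain ⟨h1, h2⟩ := key _ _ hlt hj' hj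
    exact ⟨h1.symm, h2.symm⟩

theorem IsCond.agree_succ (h : (succ α ζ n τ w p v).IsCond κ) {ξ : Iio θ.ord}
    {j : Ordinal.{u}} (hj : j ∈ (p ξ).supp) : Agree α (p ξ) (succ α ζ n τ w p v) j j := by
  intro β hβ
  refine ⟨fun y => ⟨fun h' => .inl ⟨hβ, ξ, hj, h'⟩, ?_⟩,
    fun l t => ⟨fun h' => .inl ⟨hβ, ξ, hj, h'⟩, ?_⟩⟩
  · rintro (⟨-, ξ', hj', h'⟩ | ⟨e, -⟩ | ⟨e, -⟩ | ⟨e, -⟩)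
    · exact (((h.agree_components hj hj').1 β hβ).1 y).2 h'
    all_goals exact absurd e hβ.ne
  · rintro (⟨-, ξ', hj', h'⟩ | ⟨e, -⟩ | ⟨e, -⟩)
    · exact (((h.agree_components hj hj').1 β hβ).2 l t).2 h'
    all_goals exact absurd e hβ.ne

/-- The values `θ`, `θ + 1` and `ξ < θ` are distinct, so level `α` of `h` recovers the root, the
distinguished component and all the others. The distinguished index is the only one below `θ` that
is not a value. -/
theorem hist_succ_root {j : Ordinal.{u}} :
    (succ α ζ n τ w p v).Hist j α θ.ord ↔ j ∈ w := by
  constructor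
  · rintro (⟨e, -⟩ | ⟨-, h, -⟩ | ⟨-, -, e⟩ | ⟨-, ξ, -, -, e⟩)
    · exact absurd e (lt_irrefl _)
    · exact h
    · exact absurd e (Order.lt_succ _).ne
    · exact absurd e (mem_Iio.1 ξ.2).ne'
  · exact fun h => .inr (.inl ⟨rfl, h, rfl⟩)

theorem hist_succ_star {j : Ordinal.{u}} :
    (succ α ζ n τ w p v).Hist j α (θ.ord + 1) ↔ j ∈ (p ζ).supp \ w := by
  constructor
  · rintro (⟨e, -⟩ | ⟨-, h, e⟩ | ⟨-, h, e⟩ | ⟨-, ξ, -, -, e⟩)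
    · exact absurd e (lt_irrefl _)
    · exact absurd e (Order.lt_succ _).ne'
    · exact h
    · exact absurd e ((mem_Iio.1 ξ.2).trans (Order.lt_succ _)).ne'
  · exact fun h => .inr (.inr (.inl ⟨rfl, h, rfl⟩))

theorem hist_succ_index {j : Ordinal.{u}} {ξ : Iio θ.ord} :
    (succ α ζ n τ w p v).Hist j α ξ ↔ ξ ≠ ζ ∧ j ∈ (p ξ).supp \ w := by
  constructor
  · rintro (⟨e, -⟩ | ⟨-, h, e⟩ | ⟨-, h, e⟩ | ⟨-, ξ, h1, h2, e⟩)
    · exact absurd e (lt_irrefl _)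
    · exact absurd e (mem_Iio.1 ξ.2).ne
    · exact absurd e ((mem_Iio.1 ξ.2).trans (Order.lt_succ _)).ne
    · obtain rfl := Subtype.ext e
      exact ⟨h1, h2⟩
  · exact fun h => .inr (.inr (.inr ⟨rfl, ξ, h.1, h.2, rfl⟩))

theorem IsCond.gist_succ_true (h : (succ α ζ n τ w p v).IsCond κ) {ξ : Iio θ.ord}
    {j : Ordinal.{u}} (hj : j ∈ (p ξ).supp) {t : Σ n, BoolTerm n} :
    (succ α ζ n τ w p v).Gist j α true t ↔ t = ⟨n, τ⟩ ∧ j ∈ range (v ξ) := by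
  constructor
  · rintro (⟨e, -⟩ | ⟨-, -, e, ξ', hj'⟩ | ⟨-, e, -⟩)
    · exact absurd e (lt_irrefl _)
    · exact ⟨e, (h.agree_components hj ((h.2.2.2.1 ξ').2.2.1 hj')).2.2 hj'⟩
    · exact absurd e (by simp)
  · exact fun ⟨e, h'⟩ => .inr (.inl ⟨rfl, rfl, e, ξ, h'⟩)

theorem gist_succ_term {j : Ordinal.{u}} {l : Bool} {t : Σ n, BoolTerm n}
    (h : (succ α ζ n τ w p v).Gist j α l t) : t = ⟨n, τ⟩ := by
  obtain ⟨e, -⟩ | ⟨-, -, e, -⟩ | ⟨-, -, e, -⟩ := h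
  · exact absurd e (lt_irrefl _)
  · exact e
  · exact e

theorem exists_gist_succ {j : Ordinal.{u}} (hj : j ∈ (succ α ζ n τ w p v).supp) :
    ∃ l, (succ α ζ n τ w p v).Gist j α l ⟨n, τ⟩ := by
  obtain ⟨ξ, hj⟩ := mem_iUnion.1 hj
  by_cases h : j ∈ range (v ξ)
  · exact ⟨true, .inr (.inl ⟨rfl, rfl, rfl, ξ, h⟩)⟩
  · exact ⟨false, .inr (.inr ⟨rfl, rfl, rfl, ξ, hj, h⟩)⟩

end Succ

theorem LePr.agree (hθ : Cardinal.aleph0 ≤ θ) {p q : PreCond θ} (h : LePr p q)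
    (hq : q.IsCond κ) {j : Ordinal.{u}} (hj : j ∈ p.supp) : Agree p.ht p q j j := by
  induction q generalizing p with
  | base ξ => cases h; exact .refl _ _ _
  | succ α ζ n τ w q v ih =>
    cases h with
    | refl => exact .refl _ _ _
    | succ h =>
      have hc := hq.2.2.2.1 ζ
      exact (ih ζ h hc.1 hj).trans
        ((hq.agree_succ (h.supp_subset hj)).mono ((h.ht_le hc.1).trans_eq hc.2.1))
  | lim γ q ih =>
    cases h with
    | refl => exact .refl _ _ _
    | lim ξ h =>
      have hc := hq.2.2.1
      intro β hβ
      have up := ih ξ h (hc ξ).1 hj β hβ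
      -- At a limit, `h` and `g` are unions over all coordinates, so a value coming from an
      -- unrelated coordinate `ξ'` is compared with `p` inside the later of the two coordinates.
      have down : ∀ ξ', Agree p.ht p (q (max ξ ξ')) j j := fun ξ' =>
        ih _ (h.trans (hq.lePr_lim (le_max_left _ _))) (hc _).1 hj
      have lift : ∀ ξ', j ∈ (q ξ').supp → Agree (q ξ').ht (q ξ') (q (max ξ ξ')) j j :=
        fun ξ' => ih _ (hq.lePr_lim (le_max_right _ _)) (hc _).1
      refine ⟨fun y => ⟨fun h' => ⟨ξ, (up.1 y).1 h'⟩, ?_⟩,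
        fun l t => ⟨fun h' => ⟨ξ, (up.2 l t).1 h'⟩, ?_⟩⟩
      · rintro ⟨ξ', h'⟩
        obtain ⟨m1, m2, -⟩ := h'.mem hθ (hc ξ').1
        exact ((down ξ' β hβ).1 y).2 (((lift ξ' m1 β m2).1 y).1 h')
      · rintro ⟨ξ', h'⟩
        obtain ⟨m1, m2⟩ := h'.mem (hc ξ').1
        exact ((down ξ' β hβ).2 l t).2 (((lift ξ' m1 β m2).2 l t).1 h')

/-- The support of a pure predecessor of `q` can be read off from `h^q`. -/
theorem LePr.mem_supp_iff (hθ : Cardinal.aleph0 ≤ θ) {p q : PreCond θ} (h : LePr p q)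
    (hq : q.IsCond κ) {j : Ordinal.{u}} (hj : j ∈ q.supp) :
    j ∈ p.supp ↔ ∀ β, p.ht ≤ β → β < q.ht → ∃ y, θ.ord ≤ y ∧ q.Hist j β y := by
  induction q generalizing p with
  | base ξ => cases h; exact ⟨fun _ β h1 h2 => absurd h2 (not_lt.2 h1), fun _ => hj⟩
  | succ α ζ n τ w q v ih =>
    cases h with
    | refl => exact ⟨fun _ β h1 h2 => absurd h2 (not_lt.2 h1), fun _ => hj⟩
    | succ h =>
      have hc := hq.2.2.2.1 ζ
      have hα : α < (PreCond.succ α ζ n τ w q v).ht := Order.lt_succ α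
      constructor
      · intro hp β h1 h2
        have hjζ := h.supp_subset hp
        rcases (Order.lt_succ_iff.1 h2).eq_or_lt with rfl | hβ
        · by_cases hw : j ∈ w
          · exact ⟨_, le_rfl, hist_succ_root.2 hw⟩
          · exact ⟨_, (Order.lt_succ _).le, hist_succ_star.2 ⟨hjζ, hw⟩⟩
        · obtain ⟨y, hy, h'⟩ := (ih ζ h hc.1 hjζ).1 hp β h1 (hβ.trans_eq hc.2.1.symm)
          exact ⟨y, hy, ((hq.agree_succ hjζ β hβ).1 y).1 h'⟩
      · intro H
        -- At level `α` a value at least `θ` means root or distinguished component; points outside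
        -- the distinguished component get a value below `θ`.
        have hjζ : j ∈ (q ζ).supp := by
          obtain ⟨y, hy, h'⟩ := H α ((h.ht_le hc.1).trans_eq hc.2.1) hα
          obtain ⟨e, -⟩ | ⟨-, h', -⟩ | ⟨-, h', -⟩ | ⟨-, ξ, -, -, rfl⟩ := h'
          · exact absurd e (lt_irrefl _)
          · exact hq.root_subset hθ ζ h'
          · exact h'.1
          · exact absurd hy (not_le.2 ξ.2)
        refine (ih ζ h hc.1 hjζ).2 fun β h1 h2 => ?_
        have h2 := h2.trans_eq hc.2.1
        obtain ⟨y, hy, h'⟩ := H β h1 (h2.trans hα)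
        exact ⟨y, hy, ((hq.agree_succ hjζ β h2).1 y).2 h'⟩
  | lim γ q ih =>
    cases h with
    | refl => exact ⟨fun _ β h1 h2 => absurd h2 (not_lt.2 h1), fun _ => hj⟩
    | lim ξ h =>
      have hc := hq.2.2.1
      constructor
      · intro hp β h1 h2
        -- The coordinate of index `β + 1` is the first one high enough to have `β` below its
        -- height.
        set m : Iio γ := max ξ ⟨β + 1, hq.2.1.succ_lt h2⟩
        have hm := h.trans (hq.lePr_lim (le_max_left ξ ⟨β + 1, hq.2.1.succ_lt h2⟩))
        have hβm : β < m := (Order.lt_succ β).trans_le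
          (Subtype.coe_le_coe.2 (le_max_right ξ ⟨β + 1, hq.2.1.succ_lt h2⟩))
        obtain ⟨y, hy, h'⟩ := (ih m hm (hc m).1 (hm.supp_subset hp)).1 hp β h1
          (hβm.trans_eq (hc m).2.symm)
        exact ⟨y, hy, m, h'⟩
      · intro H
        obtain ⟨ξ', hj⟩ := mem_iUnion.1 hj
        have hj := (hq.lePr_lim (le_max_right ξ ξ')).supp_subset hj
        refine (ih _ (h.trans (hq.lePr_lim (le_max_left ξ ξ'))) (hc _).1 hj).2 fun β h1 h2 => ?_
        obtain ⟨y, hy, h'⟩ := H β h1 ((h2.trans_eq (hc _).2).trans (max ξ ξ').2)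
        have := LePr.agree hθ (.lim (max ξ ξ') (.refl _)) hq hj
        exact ⟨y, hy, ((this β h2).1 y).2 h'⟩

end PreCond

end Historic

namespace Historic

namespace PreCond

open Set

variable {θ κ : Cardinal.{u}}

/-! ### Copies of conditions along maps of ordinals -/

open Classical in
/-- The composition of `v` with `H`, if it is increasing. -/
noncomputable def mapEnum {n : ℕ} (H : Ordinal.{u} → Ordinal.{u}) (v : Fin n ↪o Ordinal.{u}) :
    Fin n ↪o Ordinal.{u} :=
  if h : StrictMono (H ∘ v) then OrderEmbedding.ofStrictMono (H ∘ v) h else v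

theorem mapEnum_apply {n : ℕ} {H : Ordinal.{u} → Ordinal.{u}} {v : Fin n ↪o Ordinal.{u}}
    {s : Set Ordinal.{u}} (hH : StrictMonoOn H s) (hv : range v ⊆ s) (k : Fin n) :
    mapEnum H v k = H (v k) := by
  have h : StrictMono (H ∘ v) := fun a b hab =>
    hH (hv (mem_range_self a)) (hv (mem_range_self b)) (v.strictMono hab)
  simp [mapEnum, h]

theorem range_mapEnum {n : ℕ} {H : Ordinal.{u} → Ordinal.{u}} {v : Fin n ↪o Ordinal.{u}}
    {s : Set Ordinal.{u}} (hH : StrictMonoOn H s) (hv : range v ⊆ s) :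
    range (mapEnum H v) = H '' range v := by
  rw [← range_comp]
  exact congrArg range (funext (mapEnum_apply hH hv))

/-- The copy of a raw condition along a map of ordinals. -/
noncomputable def map (H : Ordinal.{u} → Ordinal.{u}) : PreCond θ → PreCond θ
  | base ξ => base (H ξ)
  | succ α ζ n τ w p v =>
      succ α ζ n τ (H '' w) (fun ξ => (p ξ).map H) (fun ξ => mapEnum H (v ξ))
  | lim γ p => lim γ (fun ξ => (p ξ).map H)

@[simp] theorem ht_map (H : Ordinal.{u} → Ordinal.{u}) (p : PreCond θ) :
    (p.map H).ht = p.ht := by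
  cases p <;> rfl

@[simp] theorem supp_map (H : Ordinal.{u} → Ordinal.{u}) (p : PreCond θ) :
    (p.map H).supp = H '' p.supp := by
  induction p with
  | base ξ => simp [map, supp]
  | succ α ζ n τ w p v ih => simp [map, supp, image_iUnion, ih]
  | lim γ p ih => simp [map, supp, image_iUnion, ih]

theorem LePr.map {p q : PreCond θ} (h : LePr p q) (H : Ordinal.{u} → Ordinal.{u}) :
    LePr (p.map H) (q.map H) := by
  induction h with
  | refl => exact .refl _
  | succ _ ih => exact .succ ih
  | lim ξ _ ih => exact .lim ξ ih

theorem Le.map {p q : PreCond θ} (h : Le p q) (H : Ordinal.{u} → Ordinal.{u}) :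
    Le (p.map H) (q.map H) := by
  induction h with
  | base => exact .base _
  | succ ξ _ ih => exact .succ ξ ih
  | succ_succ _ hs ih => exact .succ_succ ih fun ξ => by simp [hs ξ]
  | lim ξ _ ih => exact .lim ξ ih
  | lim_lim δ _ ih => exact .lim_lim δ ih

theorem Equiv.map {p q : PreCond θ} (h : Equiv p q) (H : Ordinal.{u} → Ordinal.{u}) :
    Equiv (p.map H) (q.map H) := ⟨h.1.map H, h.2.map H⟩

theorem map_congr {p : PreCond θ} (hθ : Cardinal.aleph0 ≤ θ) (hp : p.IsCond κ)
    {G H : Ordinal.{u} → Ordinal.{u}} (h : EqOn G H p.supp) : p.map G = p.map H := by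
  induction p with
  | base ξ => simp [map, h (mem_singleton ξ)]
  | succ α ζ n τ w p v ih =>
    simp only [map]
    congr 1
    · exact image_congr (h.mono ((hp.root_subset hθ ζ).trans (supp_subset_succ ζ)))
    · exact funext fun ξ => ih ξ (hp.2.2.2.1 ξ).1 (h.mono (supp_subset_succ ξ))
    · funext ξ
      have e : G ∘ v ξ = H ∘ v ξ := funext fun k =>
        h (supp_subset_succ ξ ((hp.2.2.2.1 ξ).2.2.1 (mem_range_self k)))
      simp only [mapEnum, e]
  | lim γ p ih =>
    simp only [map]
    congr 1
    exact funext fun ξ => ih ξ (hp.2.2.1 ξ).1 (h.mono (supp_subset_lim ξ))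

theorem map_id (p : PreCond θ) : p.map id = p := by
  induction p with
  | base ξ => rfl
  | succ α ζ n τ w p v ih =>
    simp only [map, ih, image_id]
    congr 1
    funext ξ
    ext k
    exact mapEnum_apply (strictMono_id.strictMonoOn univ) (subset_univ _) k
  | lim γ p ih => simp only [map, ih]

theorem range_enum_subset_supp {α : Ordinal.{u}} {ζ : Iio θ.ord} {n : ℕ} {τ : BoolTerm n}
    {w : Set Ordinal.{u}} {p : Iio θ.ord → PreCond θ} {v : Iio θ.ord → (Fin n ↪o Ordinal.{u})}
    (hp : (succ α ζ n τ w p v).IsCond κ) (ξ : Iio θ.ord) :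
    range (v ξ) ⊆ (succ α ζ n τ w p v).supp :=
  (hp.2.2.2.1 ξ).2.2.1.trans (supp_subset_succ ξ)

theorem map_map {p : PreCond θ} (hp : p.IsCond κ) {G H : Ordinal.{u} → Ordinal.{u}}
    (hG : StrictMonoOn G p.supp) (hH : StrictMonoOn H (G '' p.supp)) :
    (p.map G).map H = p.map (H ∘ G) := by
  induction p with
  | base ξ => rfl
  | succ α ζ n τ w p v ih =>
    simp only [map]
    congr 1
    · rw [image_comp]
    · exact funext fun ξ => ih ξ (hp.2.2.2.1 ξ).1 (hG.mono (supp_subset_succ ξ))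
        (hH.mono (image_mono (supp_subset_succ ξ)))
    · funext ξ
      have hv := range_enum_subset_supp hp ξ
      ext k
      rw [mapEnum_apply hH (by rw [range_mapEnum hG hv]; exact image_mono hv),
        mapEnum_apply hG hv, mapEnum_apply (hH.comp hG (mapsTo_image _ _)) hv]
      rfl
  | lim γ p ih =>
    simp only [map]
    congr 1
    exact funext fun ξ => ih ξ (hp.2.2.1 ξ).1 (hG.mono (supp_subset_lim ξ))
      (hH.mono (image_mono (supp_subset_lim ξ)))

theorem sat_map {p : PreCond θ} (hp : p.IsCond κ) {H : Ordinal.{u} → Ordinal.{u}}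
    (hH : StrictMonoOn H p.supp) (f : Ordinal.{u} → Bool) :
    (p.map H).Sat f ↔ p.Sat (f ∘ H) := by
  induction p with
  | base ξ => exact Iff.rfl
  | succ α ζ n τ w p v ih =>
    have e : termVal τ (fun ξ => mapEnum H (v ξ)) f = termVal τ v (f ∘ H) := by
      funext ξ
      unfold termVal
      split_ifs with h
      · congr 1
        funext k
        rw [mapEnum_apply hH (range_enum_subset_supp hp _)]
        rfl
      · rfl
    simp only [map, Sat, e]
    exact and_congr_left' (forall_congr' fun ξ =>
      ih ξ (hp.2.2.2.1 ξ).1 (hH.mono (supp_subset_succ ξ)))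
  | lim γ p ih =>
    exact forall_congr' fun ξ => ih ξ (hp.2.2.1 ξ).1 (hH.mono (supp_subset_lim ξ))

theorem sat_congr {p : PreCond θ} (hp : p.IsCond κ) {f g : Ordinal.{u} → Bool}
    (h : EqOn f g p.supp) : p.Sat f ↔ p.Sat g := by
  induction p with
  | base ξ => exact Iff.rfl
  | succ α ζ n τ w p v ih =>
    have e : termVal τ v f = termVal τ v g := by
      funext ξ
      unfold termVal
      split_ifs with hξ
      · congr 1
        exact funext fun k => h (range_enum_subset_supp hp ⟨ξ, hξ⟩ (mem_range_self k))
      · rfl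
    simp only [Sat, e]
    exact and_congr_left' (forall_congr' fun ξ =>
      ih ξ (hp.2.2.2.1 ξ).1 (h.mono (supp_subset_succ ξ)))
  | lim γ p ih =>
    exact forall_congr' fun ξ => ih ξ (hp.2.2.1 ξ).1 (h.mono (supp_subset_lim ξ))

/-- The copy need not be a condition, so `Hist.mem` does not apply to it. -/
theorem Hist.mem_of_map (hθ : Cardinal.aleph0 ≤ θ) {p : PreCond θ} (hp : p.IsCond κ)
    {H : Ordinal.{u} → Ordinal.{u}} {j β y : Ordinal.{u}} (h : (p.map H).Hist j β y) :
    j ∈ H '' p.supp := by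
  induction p with
  | base ξ => exact h.elim
  | succ α ζ n τ w p v ih =>
    have hs : ∀ ξ, H '' (p ξ).supp ⊆ H '' (PreCond.succ α ζ n τ w p v).supp :=
      fun ξ => image_mono (supp_subset_succ ξ)
    simp only [PreCond.map, Hist, supp_map] at h
    obtain ⟨-, ξ, hj, -⟩ | ⟨-, hj, -⟩ | ⟨-, hj, -⟩ | ⟨-, ξ, -, hj, -⟩ := h
    · exact hs ξ hj
    · exact hs ζ (image_mono (hp.root_subset hθ ζ) hj)
    · exact hs ζ hj.1
    · exact hs ξ hj.1
  | lim γ p ih =>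
    obtain ⟨ξ, h⟩ := h
    exact image_mono (supp_subset_lim ξ) (ih ξ (hp.2.2.1 ξ).1 h)

theorem Gist.mem_of_map {p : PreCond θ} (hp : p.IsCond κ)
    {H : Ordinal.{u} → Ordinal.{u}} (hH : StrictMonoOn H p.supp) {j β : Ordinal.{u}} {l : Bool}
    {t : Σ n, BoolTerm n} (h : (p.map H).Gist j β l t) : j ∈ H '' p.supp := by
  induction p with
  | base ξ => exact h.elim
  | succ α ζ n τ w p v ih =>
    have hs : ∀ ξ, H '' (p ξ).supp ⊆ H '' (PreCond.succ α ζ n τ w p v).supp :=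
      fun ξ => image_mono (supp_subset_succ ξ)
    simp only [PreCond.map, Gist, supp_map] at h
    obtain ⟨-, ξ, hj, -⟩ | ⟨-, -, -, ξ, hj⟩ | ⟨-, -, -, ξ, hj⟩ := h
    · exact hs ξ hj
    · have hv := range_enum_subset_supp hp ξ
      rw [range_mapEnum hH hv] at hj
      exact image_mono hv hj
    · exact hs ξ hj.1
  | lim γ p ih =>
    obtain ⟨ξ, h⟩ := h
    exact image_mono (supp_subset_lim ξ)
      (ih ξ (hp.2.2.1 ξ).1 (hH.mono (supp_subset_lim ξ)) h)

theorem hist_map (hθ : Cardinal.aleph0 ≤ θ) {p : PreCond θ} (hp : p.IsCond κ)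
    {H : Ordinal.{u} → Ordinal.{u}} (hH : StrictMonoOn H p.supp) {j : Ordinal.{u}}
    (hj : j ∈ p.supp) (β y : Ordinal.{u}) : (p.map H).Hist (H j) β y ↔ p.Hist j β y := by
  induction p with
  | base ξ => exact Iff.rfl
  | succ α ζ n τ w p v ih =>
    have hs : ∀ ξ, (p ξ).supp ⊆ (succ α ζ n τ w p v).supp := supp_subset_succ
    have hw := (hp.root_subset hθ ζ).trans (hs ζ)
    have hm : ∀ {s : Set Ordinal.{u}}, s ⊆ (succ α ζ n τ w p v).supp → (H j ∈ H '' s ↔ j ∈ s) :=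
      fun h => hH.injOn.mem_image_iff h hj
    have hd : ∀ ξ, H j ∈ H '' (p ξ).supp \ H '' w ↔ j ∈ (p ξ).supp \ w := fun ξ =>
      and_congr (hm (hs ξ)) (not_congr (hm hw))
    simp only [map, Hist, supp_map, hd, hm hw]
    refine or_congr (and_congr_right fun _ => exists_congr fun ξ => ?_) Iff.rfl
    rw [hm (hs ξ)]
    exact and_congr_right fun hξ => ih ξ (hp.2.2.2.1 ξ).1 (hH.mono (hs ξ)) hξ
  | lim γ p ih =>
    have hs : ∀ ξ, (p ξ).supp ⊆ (lim γ p).supp := supp_subset_lim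
    refine exists_congr fun ξ => ?_
    have hc := hp.2.2.1 ξ
    by_cases hξ : j ∈ (p ξ).supp
    · exact ih ξ hc.1 (hH.mono (hs ξ)) hξ
    · exact ⟨fun h => absurd ((hH.injOn.mem_image_iff (hs ξ) hj).1 (h.mem_of_map hθ hc.1)) hξ,
        fun h => absurd (h.mem hθ hc.1).1 hξ⟩

theorem gist_map {p : PreCond θ} (hp : p.IsCond κ)
    {H : Ordinal.{u} → Ordinal.{u}} (hH : StrictMonoOn H p.supp) {j : Ordinal.{u}}
    (hj : j ∈ p.supp) (β : Ordinal.{u}) (l : Bool) (t : Σ n, BoolTerm n) :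
    (p.map H).Gist (H j) β l t ↔ p.Gist j β l t := by
  induction p with
  | base ξ => exact Iff.rfl
  | succ α ζ n τ w p v ih =>
    have hs : ∀ ξ, (p ξ).supp ⊆ (succ α ζ n τ w p v).supp := supp_subset_succ
    have hv := range_enum_subset_supp hp
    have hm : ∀ {s : Set Ordinal.{u}}, s ⊆ (succ α ζ n τ w p v).supp → (H j ∈ H '' s ↔ j ∈ s) :=
      fun h => hH.injOn.mem_image_iff h hj
    have hr : ∀ ξ, H j ∈ range (mapEnum H (v ξ)) ↔ j ∈ range (v ξ) := fun ξ => by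
      rw [range_mapEnum hH (hv ξ), hm (hv ξ)]
    have hd : ∀ ξ, H j ∈ H '' (p ξ).supp \ range (mapEnum H (v ξ)) ↔
        j ∈ (p ξ).supp \ range (v ξ) := fun ξ =>
      and_congr (hm (hs ξ)) (not_congr (hr ξ))
    simp only [map, Gist, supp_map, hd, hr]
    refine or_congr (and_congr_right fun _ => exists_congr fun ξ => ?_) Iff.rfl
    rw [hm (hs ξ)]
    exact and_congr_right fun hξ => ih ξ (hp.2.2.2.1 ξ).1 (hH.mono (hs ξ)) hξ
  | lim γ p ih =>
    have hs : ∀ ξ, (p ξ).supp ⊆ (lim γ p).supp := supp_subset_lim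
    refine exists_congr fun ξ => ?_
    have hc := hp.2.2.1 ξ
    have hHξ := hH.mono (hs ξ)
    by_cases hξ : j ∈ (p ξ).supp
    · exact ih ξ hc.1 hHξ hξ
    · exact ⟨fun h => absurd ((hH.injOn.mem_image_iff (hs ξ) hj).1 (h.mem_of_map hc.1 hHξ)) hξ,
        fun h => absurd (h.mem hc.1).1 hξ⟩

theorem agree_map (hθ : Cardinal.aleph0 ≤ θ) {p : PreCond θ} (hp : p.IsCond κ)
    {H : Ordinal.{u} → Ordinal.{u}} (hH : StrictMonoOn H p.supp) {j : Ordinal.{u}}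
    (hj : j ∈ p.supp) (α : Ordinal.{u}) : Agree α p (p.map H) j (H j) :=
  fun β _ => ⟨fun y => (hist_map hθ hp hH hj β y).symm,
    fun l t => (gist_map hp hH hj β l t).symm⟩

/-! ### A condition is determined by its support and its history -/

/-- By induction on `p`. At a successor, the top level of `h` gives back the root, the distinguished
index and the supports of the components, and that of `g` gives the term and the finite sets. At a
limit, `LePr.mem_supp_iff` gives back the supports of the coordinates. -/
theorem eq_map_of_agree (hθ : Cardinal.aleph0 ≤ θ) {p q : PreCond θ} (hp : p.IsCond κ)
    (hq : q.IsCond κ) (hht : p.ht = q.ht) {H : Ordinal.{u} → Ordinal.{u}}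
    (hH : StrictMonoOn H p.supp) (hs : H '' p.supp = q.supp)
    (ha : ∀ j ∈ p.supp, Agree p.ht p q j (H j)) : q = p.map H := by
  induction p generalizing q with
  | base ξ =>
    cases q with
    | base ξ' =>
      simp only [supp, image_singleton, singleton_eq_singleton_iff] at hs
      rw [← hs]; rfl
    | succ α ζ n τ w q v => exact absurd hht (Order.succ_ne_bot α).symm
    | lim γ q => exact absurd hht hq.2.1.bot_lt.ne
  | succ α ζ n τ w p v ih =>
    cases q with
    | base ξ' => exact absurd hht (Order.succ_ne_bot α)
    | lim γ q => exact absurd hq.2.1 ((show α + 1 = γ from hht) ▸ Order.not_isSuccLimit_succ α)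
    | succ α' ζ' n' τ' w' q v' =>
      obtain rfl : α = α' := Order.succ_injective hht
      have hα : α < (succ α ζ n τ w p v).ht := Order.lt_succ α
      have hsp : ∀ ξ, (p ξ).supp ⊆ (succ α ζ n τ w p v).supp := supp_subset_succ
      have hsq : ∀ ξ, (q ξ).supp ⊆ (succ α ζ' n' τ' w' q v').supp := supp_subset_succ
      have hwp := hp.root_subset hθ
      have hwq := hq.root_subset hθ
      have himg : ∀ {s t : Set Ordinal.{u}}, s ⊆ (succ α ζ n τ w p v).supp →
          t ⊆ (succ α ζ' n' τ' w' q v').supp →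
          (∀ j ∈ (succ α ζ n τ w p v).supp, j ∈ s ↔ H j ∈ t) → H '' s = t := by
        intro s t h1 h2 h
        apply Subset.antisymm
        · rintro _ ⟨j, hj, rfl⟩
          exact (h j (h1 hj)).1 hj
        · intro i hi
          obtain ⟨j, hj, rfl⟩ := hs.symm ▸ h2 hi
          exact ⟨j, (h j hj).2 hi, rfl⟩
      have hhist : ∀ j ∈ (succ α ζ n τ w p v).supp, ∀ y, (succ α ζ n τ w p v).Hist j α y ↔
          (succ α ζ' n' τ' w' q v').Hist (H j) α y := fun j hj y => (ha j hj α hα).1 y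
      have hw : H '' w = w' := himg ((hwp ζ).trans (hsp ζ)) ((hwq ζ).trans (hsq ζ))
        fun j hj => by simpa only [hist_succ_root] using hhist j hj θ.ord
      -- If they differed, `ζ'` would be a value of the first `h` at level `α`, but it never is one
      -- of the second.
      have hζ : ζ = ζ' := by
        by_contra hne
        obtain ⟨j, hj⟩ := (hp.2.2.2.1 ζ').2.2.2.1
        have := (hhist j (hsp ζ' hj.1) ζ').1 (hist_succ_index.2 ⟨Ne.symm hne, hj⟩)
        exact (hist_succ_index.1 this).1 rfl
      subst hζ
      have hd : ∀ ξ, H '' ((p ξ).supp \ w) = (q ξ).supp \ w' := by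
        intro ξ
        refine himg (sdiff_subset.trans (hsp ξ)) (sdiff_subset.trans (hsq ξ)) fun j hj => ?_
        by_cases hξ : ξ = ζ
        · subst hξ
          simpa only [hist_succ_star] using hhist j hj (θ.ord + 1)
        · simpa only [hist_succ_index, ne_eq, hξ, not_false_eq_true, true_and]
            using hhist j hj ξ
      have hsupp : ∀ ξ, H '' (p ξ).supp = (q ξ).supp := fun ξ => by
        rw [← union_sdiff_cancel (hwp ξ), image_union, hw, hd, union_sdiff_cancel (hwq ξ)]
      have ht : (⟨n', τ'⟩ : Σ n, BoolTerm n) = ⟨n, τ⟩ := by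
        obtain ⟨j, hj⟩ := hp.supp_nonempty
        obtain ⟨l, hl⟩ := exists_gist_succ hj
        exact (gist_succ_term (((ha j hj α hα).2 l _).1 hl)).symm
      obtain ⟨rfl, e⟩ := Sigma.mk.inj_iff.1 ht
      obtain rfl := eq_of_heq e
      have hv : ∀ ξ, v' ξ = mapEnum H (v ξ) := by
        intro ξ
        have hvp := range_enum_subset_supp hp ξ
        -- Increasing enumerations are determined by their ranges.
        apply OrderEmbedding.range_inj.1
        rw [range_mapEnum hH hvp]
        symm
        refine himg hvp (range_enum_subset_supp hq ξ) fun j hj => ?_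
        by_cases hξ : j ∈ (p ξ).supp
        · have h1 := (ha j hj α hα).2 true ⟨n', τ'⟩
          rw [hp.gist_succ_true hξ, hq.gist_succ_true (hsupp ξ ▸ mem_image_of_mem H hξ)] at h1
          simpa using h1
        · refine iff_of_false (fun h => hξ ((hp.2.2.2.1 ξ).2.2.1 h)) fun h => hξ ?_
          have := (hq.2.2.2.1 ξ).2.2.1 h
          rwa [← hsupp, hH.injOn.mem_image_iff (hsp ξ) hj] at this
      simp only [map]
      congr 1
      · exact hw.symm
      · funext ξ
        have hcp := hp.2.2.2.1 ξ
        have hcq := hq.2.2.2.1 ξ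
        refine ih ξ hcp.1 hcq.1 (hcp.2.1.trans hcq.2.1.symm) (hH.mono (hsp ξ)) (hsupp ξ)
          fun j hj => ?_
        rw [hcp.2.1]
        exact ((hp.agree_succ hj).trans ((ha j (hsp ξ hj)).mono hα.le)).trans
          (hq.agree_succ (hsupp ξ ▸ mem_image_of_mem H hj)).symm
      · exact funext hv
  | lim γ p ih =>
    cases q with
    | base ξ' => exact absurd hht hp.2.1.bot_lt.ne'
    | succ α ζ n τ w q v =>
      exact absurd hp.2.1 ((show γ = α + 1 from hht) ▸ Order.not_isSuccLimit_succ α)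
    | lim γ' q =>
      obtain rfl : γ = γ' := hht
      have hsp : ∀ ξ, (p ξ).supp ⊆ (lim γ p).supp := supp_subset_lim
      have hlp : ∀ ξ, LePr (p ξ) (lim γ p) := fun ξ => .lim ξ (.refl _)
      have hlq : ∀ ξ, LePr (q ξ) (lim γ q) := fun ξ => .lim ξ (.refl _)
      have hiff : ∀ ξ, ∀ j ∈ (lim γ p).supp, j ∈ (p ξ).supp ↔ H j ∈ (q ξ).supp := by
        intro ξ j hj
        rw [(hlp ξ).mem_supp_iff hθ hp hj,
          (hlq ξ).mem_supp_iff hθ hq (hs ▸ mem_image_of_mem H hj), (hp.2.2.1 ξ).2,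
          (hq.2.2.1 ξ).2]
        exact forall_congr' fun β => forall_congr' fun _ => forall_congr' fun hβ =>
          exists_congr fun y => and_congr_right fun _ => (ha j hj β hβ).1 y
      have hsupp : ∀ ξ, H '' (p ξ).supp = (q ξ).supp := by
        intro ξ
        apply Subset.antisymm
        · rintro _ ⟨j, hj, rfl⟩
          exact (hiff ξ j (hsp ξ hj)).1 hj
        · intro i hi
          obtain ⟨j, hj, rfl⟩ := hs.symm ▸ supp_subset_lim ξ hi
          exact ⟨j, (hiff ξ j hj).2 hi, rfl⟩
      simp only [map]
      congr 1
      funext ξ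
      have hcp := hp.2.2.1 ξ
      have hcq := hq.2.2.1 ξ
      refine ih ξ hcp.1 hcq.1 (hcp.2.trans hcq.2.symm) (hH.mono (hsp ξ)) (hsupp ξ)
          fun j hj => ?_
      have h1 := (hlp ξ).agree hθ hp hj
      have h2 := (hlq ξ).agree hθ hq (hsupp ξ ▸ mem_image_of_mem H hj)
      have e : (p ξ).ht = (q ξ).ht := hcp.2.trans hcq.2.symm
      exact (h1.trans ((ha j (hsp ξ hj)).mono (hcp.2.trans_le ξ.2.le))).trans (e ▸ h2.symm)

end PreCond

end Historic

namespace Historic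

namespace PreCond

open Set

variable {θ κ : Cardinal.{u}}

/-! ### Isomorphic conditions -/

/-- The conditions `p` and `q` are isomorphic, by an isomorphism that is the identity on `w` and
sends the range of `v` to the range of `v'`. -/
def IsoOver {n : ℕ} (α : Ordinal.{u}) (w : Set Ordinal.{u}) (v v' : Fin n ↪o Ordinal.{u})
    (p q : PreCond θ) : Prop :=
  ∃ H : p.supp ≃o q.supp,
    (∀ j : p.supp, (j : Ordinal.{u}) ∈ w → (H j : Ordinal.{u}) = j) ∧
    p.F = {f | ∃ f' ∈ q.F, f = f' ∘ H} ∧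
    (∀ j : p.supp, (j : Ordinal.{u}) ∈ range v ↔ (H j : Ordinal.{u}) ∈ range v') ∧
    ∀ j : p.supp, Agree α p q j (H j)

/-- The isomorphism is `H` after the inverse of `G`; the families match because satisfaction in a
copy is satisfaction of the pulled back function in `p`. This reduces the isomorphism clause of a
successor condition to the behaviour of `G` and `H` on the root and the finite sets. -/
theorem isoOver_map (hθ : Cardinal.aleph0 ≤ θ) {n : ℕ} {α : Ordinal.{u}} {w : Set Ordinal.{u}}
    {v v' : Fin n ↪o Ordinal.{u}} {p : PreCond θ} (hp : p.IsCond κ)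
    {G H : Ordinal.{u} → Ordinal.{u}} (hG : StrictMonoOn G p.supp) (hH : StrictMonoOn H p.supp)
    (hw : ∀ j ∈ p.supp, G j ∈ w → H j = G j)
    (hv : ∀ j ∈ p.supp, G j ∈ range v ↔ H j ∈ range v') :
    IsoOver α w v v' (p.map G) (p.map H) := by
  let I := (((OrderIso.setCongr _ _ (supp_map G p)).trans (hG.orderIso G p.supp).symm).trans
    (hH.orderIso H p.supp)).trans (OrderIso.setCongr _ _ (supp_map H p)).symm
  have key : ∀ i : (p.map G).supp, ∃ j ∈ p.supp, (i : Ordinal.{u}) = G j ∧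
      (I i : Ordinal.{u}) = H j := by
    intro i
    let k := (hG.orderIso G p.supp).symm (OrderIso.setCongr _ _ (supp_map G p) i)
    refine ⟨k, k.2, ?_, rfl⟩
    exact congrArg Subtype.val ((hG.orderIso G p.supp).apply_symm_apply
      (OrderIso.setCongr _ _ (supp_map G p) i)).symm
  refine ⟨I, ?_, ?_, ?_, ?_⟩
  · intro i hi
    obtain ⟨j, hj, e1, e2⟩ := key i
    rw [e1] at hi
    rw [e1, e2, hw j hj hi]
  · have ext : ∀ {G H : Ordinal.{u} → Ordinal.{u}}, StrictMonoOn H p.supp →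
        ∀ f : Ordinal.{u} → Bool, ∃ g : Ordinal.{u} → Bool, EqOn (g ∘ H) (f ∘ G) p.supp := by
      intro G H hH f
      refine ⟨f ∘ G ∘ Function.invFunOn H p.supp, fun j hj => ?_⟩
      simp only [Function.comp_apply, hH.injOn.leftInvOn_invFunOn hj]
    apply Subset.antisymm
    · rintro f ⟨f₀, hf₀, hf⟩
      obtain ⟨f₁, h₁⟩ := ext (G := G) hH f₀
      refine ⟨fun i => f₁ i, ⟨f₁, ?_, fun _ => rfl⟩, ?_⟩
      · rw [sat_map hp hH, sat_congr hp h₁, ← sat_map hp hG]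
        exact hf₀
      · funext i
        obtain ⟨j, hj, e1, e2⟩ := key i
        rw [hf i, Function.comp_apply, e1, e2]
        exact (h₁ hj).symm
    · rintro _ ⟨f, ⟨f₀, hf₀, hf⟩, rfl⟩
      obtain ⟨f₁, h₁⟩ := ext (G := H) hG f₀
      refine ⟨f₁, ?_, fun i => ?_⟩
      · rw [sat_map hp hG, sat_congr hp h₁, ← sat_map hp hH]
        exact hf₀
      · obtain ⟨j, hj, e1, e2⟩ := key i
        rw [Function.comp_apply, hf, e1, e2]
        exact (h₁ hj).symm
  · intro i
    obtain ⟨j, hj, e1, e2⟩ := key i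
    rw [e1, e2]
    exact hv j hj
  · intro i
    obtain ⟨j, hj, e1, e2⟩ := key i
    rw [e1, e2]
    exact (agree_map hθ hp hG hj α).symm.trans (agree_map hθ hp hH hj α)

/-- By rigidity an isomorphism makes `q` a literal copy of `p`. The equality of the families `F`
plays no part, being a consequence. -/
theorem IsoOver.exists_map (hθ : Cardinal.aleph0 ≤ θ) {n : ℕ} {w : Set Ordinal.{u}}
    {v v' : Fin n ↪o Ordinal.{u}} {p q : PreCond θ} (hp : p.IsCond κ) (hq : q.IsCond κ)
    (e : p.ht = q.ht) (h : IsoOver p.ht w v v' p q) :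
    ∃ G : Ordinal.{u} → Ordinal.{u}, StrictMonoOn G p.supp ∧ q = p.map G ∧
      (∀ j ∈ p.supp, j ∈ w → G j = j) ∧ (∀ j ∈ p.supp, j ∈ range v ↔ G j ∈ range v') := by
  obtain ⟨H, hw, -, hv, ha⟩ := h
  classical
  let G : Ordinal.{u} → Ordinal.{u} := fun j => if hj : j ∈ p.supp then H ⟨j, hj⟩ else j
  have hG : ∀ (j) (hj : j ∈ p.supp), G j = H ⟨j, hj⟩ := fun j hj => dif_pos hj
  have hm : StrictMonoOn G p.supp := by
    intro i hi j hj hij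
    rw [hG i hi, hG j hj]
    exact H.strictMono (Subtype.mk_lt_mk.2 hij)
  refine ⟨G, hm, eq_map_of_agree hθ hp hq e hm ?_ ?_, ?_, ?_⟩
  · apply Subset.antisymm
    · rintro _ ⟨j, hj, rfl⟩
      rw [hG j hj]
      exact (H _).2
    · intro i hi
      refine ⟨H.symm ⟨i, hi⟩, (H.symm ⟨i, hi⟩).2, ?_⟩
      rw [hG _ (H.symm ⟨i, hi⟩).2]
      simp
  · intro j hj
    rw [hG j hj]
    exact ha ⟨j, hj⟩
  · intro j hj hjw
    rw [hG j hj]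
    exact hw ⟨j, hj⟩ hjw
  · intro j hj
    rw [hG j hj]
    exact hv ⟨j, hj⟩

theorem IsoOver.map (hθ : Cardinal.aleph0 ≤ θ) {n : ℕ} {w s : Set Ordinal.{u}}
    {v v' : Fin n ↪o Ordinal.{u}} {p q : PreCond θ} (hp : p.IsCond κ) (hq : q.IsCond κ)
    (e : p.ht = q.ht) (h : IsoOver p.ht w v v' p q) {H : Ordinal.{u} → Ordinal.{u}}
    (hH : StrictMonoOn H s) (hps : p.supp ⊆ s) (hqs : q.supp ⊆ s) (hw : w ⊆ s)
    (hv : range v ⊆ s) (hv' : range v' ⊆ s) :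
    IsoOver p.ht (H '' w) (mapEnum H v) (mapEnum H v') (p.map H) (q.map H) := by
  obtain ⟨G, hG, rfl, hGw, hGv⟩ := h.exists_map hθ hp hq e
  rw [supp_map] at hqs
  rw [map_map hp hG (hH.mono hqs)]
  have hGs : ∀ {j}, j ∈ p.supp → G j ∈ s := fun hj => hqs (mem_image_of_mem G hj)
  refine isoOver_map hθ hp (hH.mono hps) (hH.comp hG fun j hj => hGs hj) ?_ ?_
  · intro j hj hjw
    rw [hH.injOn.mem_image_iff hw (hps hj)] at hjw
    rw [Function.comp_apply, hGw j hj hjw]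
  · intro j hj
    rw [range_mapEnum hH hv, range_mapEnum hH hv', Function.comp_apply,
      hH.injOn.mem_image_iff hv (hps hj), hH.injOn.mem_image_iff hv' (hGs hj), hGv j hj]

/-- If the copy of a condition is a condition, then so is the copy of each equivalent condition. -/
theorem IsCond.map_of_equiv (hθ : Cardinal.aleph0 ≤ θ) {p p' : PreCond θ} (hp : p.IsCond κ)
    (hp' : p'.IsCond κ) (h : Equiv p p') {H : Ordinal.{u} → Ordinal.{u}}
    (hH : StrictMonoOn H p.supp) (hm : (p.map H).IsCond κ) : (p'.map H).IsCond κ := by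
  have hss := h.supp_eq hp hp'
  have hht := h.ht_eq hp hp'
  obtain ⟨h, -⟩ := h
  induction h with
  | base => exact hm
  | @succ _ _ _ _ _ _ q _ ξ h _ =>
    have hc := hp'.2.2.2.1 ξ
    exact absurd (hht.ge.trans ((h.ht_le hp hc.1).trans_eq hc.2.1)) (not_le.2 (Order.lt_succ _))
  | lim ξ h _ =>
    have hc := hp'.2.2.1 ξ
    exact absurd (hht.ge.trans ((h.ht_le hp hc.1).trans_eq hc.2)) (not_le.2 ξ.2)
  | @succ_succ α ζ ζ' n τ w p q v h hs ih =>
    have hcp := hp.2.2.2.1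
    have hcq := hp'.2.2.2.1
    obtain ⟨m1, m2, m3, m4, m5⟩ := hm
    have hsp : ∀ ξ, (q ξ).supp ⊆ (PreCond.succ α ζ n τ w p v).supp :=
      fun ξ => (hs ξ).symm.subset.trans (supp_subset_succ ξ)
    have hv := range_enum_subset_supp hp
    -- A copy can fail to be a condition, since an increasing map need not preserve strict
    -- inequalities between suprema and infima. Those clauses depend only on the supports, which the
    -- two conditions share componentwise, so they transfer; the isomorphism clause is carried over
    -- by `IsoOver.map`.
    refine ⟨m1, m2, m3, fun ξ => ?_, fun ξ₀ ξ₁ hξ => ?_⟩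
    · have hmξ := m4 ξ
      simp only [supp_map, ht_map, hs ξ] at hmξ ⊢
      exact ⟨ih ξ (hcp ξ).1 (hcq ξ).1 (hH.mono (supp_subset_succ ξ)) hmξ.1 (hs ξ)
        ((hcp ξ).2.1.trans (hcq ξ).2.1.symm), (hcq ξ).2.1, hmξ.2.2⟩
    · obtain ⟨h1, h2, -⟩ := m5 ξ₀ ξ₁ hξ
      refine ⟨?_, ?_, ?_⟩
      · simpa only [supp_map, hs] using h1
      · simpa only [supp_map, hs] using h2
      · have h3 : IsoOver α w (v ξ₀) (v ξ₁) (q ξ₀) (q ξ₁) := (hp'.2.2.2.2 ξ₀ ξ₁ hξ).2.2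
        have e0 := (hcq ξ₀).2.1
        have e1 := (hcq ξ₁).2.1
        rw [← e0] at h3
        have := h3.map hθ (hcq ξ₀).1 (hcq ξ₁).1 (e0.trans e1.symm) hH (hsp _) (hsp _)
          ((hp.root_subset hθ ζ).trans (supp_subset_succ ζ)) (hv _) (hv _)
        rw [e0] at this
        exact this
  | @lim_lim γ p q δ h ih =>
    have hcp := hp.2.2.1
    have hcq := hp'.2.2.1
    obtain ⟨m1, m2, m3, m4⟩ := hm
    have hi : ∀ ξ, δ ≤ ξ → ((q ξ).map H).IsCond κ := by
      intro ξ hξ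
      have e := (hcp ξ).2.trans (hcq ξ).2.symm
      have hE : Equiv (p ξ) (q ξ) :=
        ⟨h ξ hξ, (h ξ hξ).symm_of_ht (hcp ξ).1 (hcq ξ).1 e.ge⟩
      exact ih ξ hξ (hcp ξ).1 (hcq ξ).1 (hH.mono (supp_subset_lim ξ)) (m3 ξ).1
        (hE.supp_eq (hcp ξ).1 (hcq ξ).1) e
    -- Equivalence says nothing about the coordinates before `δ`, but these are pure predecessors of
    -- later ones.
    refine ⟨m1, m2, fun ξ => ⟨?_, ?_⟩, fun ξ₀ ξ₁ hξ => (hp'.2.2.2 _ _ hξ).map H⟩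
    · exact ((hp'.lePr_lim (le_max_left ξ δ)).map H).isCond (hi _ (le_max_right _ _))
    · exact (ht_map H _).trans (hcq ξ).2

/-! ### Replacing a pure predecessor by an equivalent condition -/

open Classical in
/-- A map witnessing that `p` and `q` are isomorphic over `w`. -/
noncomputable def transport {n : ℕ} (w : Set Ordinal.{u}) (v v' : Fin n ↪o Ordinal.{u})
    (p q : PreCond θ) : Ordinal.{u} → Ordinal.{u} :=
  if h : ∃ G : Ordinal.{u} → Ordinal.{u}, StrictMonoOn G p.supp ∧ q = p.map G ∧
      (∀ j ∈ w, G j = j) ∧ (∀ j ∈ p.supp, j ∈ range v ↔ G j ∈ range v')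
  then h.choose else id

theorem transport_spec (hθ : Cardinal.aleph0 ≤ θ) {α : Ordinal.{u}} {ζ : Iio θ.ord} {n : ℕ}
    {τ : BoolTerm n} {w : Set Ordinal.{u}} {p : Iio θ.ord → PreCond θ}
    {v : Iio θ.ord → (Fin n ↪o Ordinal.{u})} (hp : (succ α ζ n τ w p v).IsCond κ)
    {ξ ξ' : Iio θ.ord} (hne : ξ ≠ ξ') :
    let G := transport w (v ξ) (v ξ') (p ξ) (p ξ')
    StrictMonoOn G (p ξ).supp ∧ p ξ' = (p ξ).map G ∧ (∀ j ∈ w, G j = j) ∧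
      (∀ j ∈ (p ξ).supp, j ∈ range (v ξ) ↔ G j ∈ range (v ξ')) := by
  have hc := hp.2.2.2.1
  have hw := hp.root_subset hθ
  have e : ∀ ξ ξ', (p ξ).ht = (p ξ').ht := fun ξ ξ' => (hc ξ).2.1.trans (hc ξ').2.1.symm
  have key : ∀ ξ ξ' : Iio θ.ord, ξ < ξ' → ∃ G : Ordinal.{u} → Ordinal.{u},
      StrictMonoOn G (p ξ).supp ∧ p ξ' = (p ξ).map G ∧ (∀ j ∈ w, G j = j) ∧
      (∀ j ∈ (p ξ).supp, j ∈ range (v ξ) ↔ G j ∈ range (v ξ')) := by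
    intro ξ ξ' hlt
    have h : IsoOver α w (v ξ) (v ξ') (p ξ) (p ξ') := (hp.2.2.2.2 ξ ξ' hlt).2.2
    rw [← (hc ξ).2.1] at h
    obtain ⟨G, h1, h2, h3, h4⟩ := h.exists_map hθ (hc ξ).1 (hc ξ').1 (e _ _)
    exact ⟨G, h1, h2, fun j hj => h3 j (hw ξ hj) hj, h4⟩
  have hex : ∃ G : Ordinal.{u} → Ordinal.{u},
      StrictMonoOn G (p ξ).supp ∧ p ξ' = (p ξ).map G ∧ (∀ j ∈ w, G j = j) ∧
      (∀ j ∈ (p ξ).supp, j ∈ range (v ξ) ↔ G j ∈ range (v ξ')) := by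
    rcases hne.lt_or_gt with hlt | hlt
    · exact key _ _ hlt
    · obtain ⟨G, h1, h2, h3, h4⟩ := key _ _ hlt
      -- The definition provides isomorphisms from smaller to larger indices only; the other
      -- direction is obtained by inverting.
      have hl := h1.injOn.leftInvOn_invFunOn
      have hs : (p ξ).supp = G '' (p ξ').supp := by rw [h2, supp_map]
      have hm : StrictMonoOn (Function.invFunOn G (p ξ').supp) (G '' (p ξ').supp) := by
        rintro _ ⟨i, hi, rfl⟩ _ ⟨j, hj, rfl⟩ hij
        rw [hl hi, hl hj]
        exact (h1.lt_iff_lt hi hj).1 hij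
      refine ⟨Function.invFunOn G (p ξ').supp, hs ▸ hm, ?_, fun j hj => ?_, fun j hj => ?_⟩
      · have hid : EqOn (Function.invFunOn G (p ξ').supp ∘ G) id (p ξ').supp := fun j hj => hl hj
        rw [h2, map_map (hc ξ').1 h1 hm, map_congr hθ (hc ξ').1 hid, map_id]
      · have := hl (hw ξ' hj)
        rwa [h3 j hj] at this
      · rw [hs] at hj
        obtain ⟨i, hi, rfl⟩ := hj
        rw [hl hi, h4 i hi]
  simp only [transport, dif_pos hex]
  exact hex.choose_spec

open Classical in
/-- A pure predecessor of `p` of height `α`. -/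
noncomputable def cut (α : Ordinal.{u}) (p : PreCond θ) : PreCond θ :=
  if h : ∃ r, LePr r p ∧ r.ht = α then h.choose else p

theorem cut_spec {p : PreCond θ} (hp : p.IsCond κ) {α : Ordinal.{u}} (h : α ≤ p.ht) :
    LePr (cut α p) p ∧ (cut α p).ht = α := by
  have h' := exists_lePr_ht hp h
  rw [cut, dif_pos h']
  exact h'.choose_spec

open Classical in
/-- The result of replacing by `r` the pure predecessor of `q` of the height of `r`. -/
noncomputable def graft (r : PreCond θ) : PreCond θ → PreCond θ
  | base _ => r
  | succ α ζ n τ w q v =>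
      if r.ht = α + 1 then r else
        succ α ζ n τ w (fun ξ => if ξ = ζ then graft r (q ζ) else
          (graft r (q ζ)).map (transport w (v ζ) (v ξ) (q ζ) (q ξ))) v
  | lim γ q =>
      if r.ht = γ then r else
        lim γ (fun ξ => if r.ht ≤ ξ then graft r (q ξ) else cut ξ r)

theorem LePr.graft {r t q : PreCond θ} (h : LePr t q) (hq : q.IsCond κ) (hr : r.ht ≤ t.ht) :
    LePr (graft r t) (graft r q) := by
  induction h with
  | refl => exact .refl _
  | @succ α ζ n τ w q v h ih =>
    have hc := hq.2.2.2.1 ζ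
    have hlt : r.ht < α + 1 :=
      Order.lt_succ_iff.2 (hr.trans ((h.ht_le hc.1).trans_eq hc.2.1))
    simp only [PreCond.graft, if_neg hlt.ne]
    refine .succ ?_
    rw [if_pos rfl]
    exact ih hc.1
  | @lim γ q ξ h ih =>
    have hc := hq.2.2.1 ξ
    have hle : r.ht ≤ ξ := hr.trans ((h.ht_le hc.1).trans_eq hc.2)
    simp only [PreCond.graft, if_neg (hle.trans_lt ξ.2).ne]
    refine .lim ξ ?_
    rw [if_pos hle]
    exact ih hc.1

/-- Grafting inside the distinguished component forces the same change in the other components, made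
by copying along the isomorphisms. At a limit, the coordinates past the height of `r` are grafted,
and the earlier ones become the predecessors of `r`. -/
theorem graft_spec (hθ : Cardinal.aleph0 ≤ θ) {r s q : PreCond θ} (hr : r.IsCond κ)
    (hq : q.IsCond κ) (hs : LePr s q) (hrs : Equiv s r) :
    (graft r q).IsCond κ ∧ Equiv q (graft r q) ∧ LePr r (graft r q) := by
  have hht : s.ht = r.ht := hrs.ht_eq (hs.isCond hq) hr
  induction q with
  | base ξ =>
    cases hs
    exact ⟨hr, hrs, .refl _⟩
  | succ α ζ n τ w q v ih =>
    have hc := hq.2.2.2.1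
    cases hs with
    | refl =>
      have : r.ht = α + 1 := hht.symm
      simp only [graft, if_pos this]
      exact ⟨hr, hrs, .refl _⟩
    | succ hs =>
      have hlt : r.ht < α + 1 :=
        Order.lt_succ_iff.2 (hht.symm.trans_le ((hs.ht_le (hc ζ).1).trans_eq (hc ζ).2.1))
      obtain ⟨g1, g2, g3⟩ := ih ζ (hc ζ).1 hs
      simp only [graft, if_neg hlt.ne]
      set g := graft r (q ζ)
      -- With the identity at `ζ`, all new components are uniformly copies of `g`.
      obtain ⟨T, hT⟩ : ∃ T : Iio θ.ord → Ordinal.{u} → Ordinal.{u}, T =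
        fun ξ => if ξ = ζ then id else transport w (v ζ) (v ξ) (q ζ) (q ξ) := ⟨_, rfl⟩
      have hcomp : (fun ξ => if ξ = ζ then g else
          g.map (transport w (v ζ) (v ξ) (q ζ) (q ξ))) = fun ξ => g.map (T ξ) := by
        funext ξ
        rw [hT]
        dsimp only
        split_ifs
        · rw [map_id]
        · rfl
      have hTs : ∀ ξ, StrictMonoOn (T ξ) (q ζ).supp ∧ q ξ = (q ζ).map (T ξ) ∧
          (∀ j ∈ w, T ξ j = j) ∧
          (∀ j ∈ (q ζ).supp, j ∈ range (v ζ) ↔ T ξ j ∈ range (v ξ)) := by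
        intro ξ
        rw [hT]
        dsimp only
        split_ifs with e
        · subst e
          exact ⟨strictMono_id.strictMonoOn _, (map_id _).symm, fun _ _ => rfl, fun _ _ => Iff.rfl⟩
        · exact transport_spec hθ hq (Ne.symm e)
      have hTζ : T ζ = id := by rw [hT]; simp
      have hsupp : g.supp = (q ζ).supp := (g2.supp_eq (hc ζ).1 g1).symm
      have hghs : ∀ ξ, (g.map (T ξ)).supp = (q ξ).supp := fun ξ => by
        rw [(hTs ξ).2.1, supp_map, supp_map, hsupp]
      have hgc : ∀ ξ, (g.map (T ξ)).IsCond κ := fun ξ =>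
        (hc ζ).1.map_of_equiv hθ g1 g2 (hTs ξ).1 ((hTs ξ).2.1 ▸ (hc ξ).1)
      have hge : ∀ ξ, Equiv (q ξ) (g.map (T ξ)) := fun ξ => by
        have := g2.map (T ξ)
        rwa [← (hTs ξ).2.1] at this
      rw [hcomp]
      refine ⟨?_, ⟨.succ_succ (fun ξ => (hge ξ).1) fun ξ => (hghs ξ).symm,
        .succ_succ (fun ξ => (hge ξ).2) hghs⟩, .succ ?_⟩
      · have hqw := hq.root_subset hθ ζ
        obtain ⟨m1, m2, m3, m4, m5⟩ := hq
        refine ⟨m1, m2, m3, fun ξ => ?_, fun ξ₀ ξ₁ hξ => ?_⟩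
        · have hmξ := m4 ξ
          rw [hghs]
          exact ⟨hgc ξ, ((hge ξ).ht_eq (hc ξ).1 (hgc ξ)).symm.trans (hc ξ).2.1, hmξ.2.2⟩
        · obtain ⟨h1, h2, -⟩ := m5 ξ₀ ξ₁ hξ
          refine ⟨?_, ?_, ?_⟩
          · simpa only [hghs] using h1
          · simpa only [hghs] using h2
          -- Each `T ξ` fixes `w` pointwise and is injective, so nothing outside `w` is sent into
          -- `w`.
          · have hTw : ∀ ξ, ∀ j ∈ g.supp, T ξ j ∈ w → j ∈ w := by
              intro ξ j hj hjw
              have e := (hTs ξ).2.2.1 _ hjw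
              rw [hsupp] at hj
              have := (hTs ξ).1.injOn (hqw hjw) hj e
              rwa [this] at hjw
            refine isoOver_map hθ g1 (hsupp ▸ (hTs ξ₀).1) (hsupp ▸ (hTs ξ₁).1) ?_ ?_
            · intro j hj hjw
              have := hTw ξ₀ j hj hjw
              rw [(hTs ξ₀).2.2.1 j this, (hTs ξ₁).2.2.1 j this]
            · intro j hj
              rw [hsupp] at hj
              rw [← (hTs ξ₀).2.2.2 j hj, (hTs ξ₁).2.2.2 j hj]
      · rwa [hTζ, map_id]
  | lim γ q ih =>
    have hc := hq.2.2.1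
    have hqc := hq
    cases hs with
    | refl =>
      have : r.ht = γ := hht.symm
      simp only [graft, if_pos this]
      exact ⟨hr, hrs, .refl _⟩
    | lim ξ hs =>
      have hlt : r.ht < γ := (hht.symm.trans_le ((hs.ht_le (hc ξ).1).trans_eq (hc ξ).2)).trans_lt ξ.2
      simp only [graft, if_neg hlt.ne]
      have hup : ∀ η : Iio γ, r.ht ≤ η → (graft r (q η)).IsCond κ ∧
          Equiv (q η) (graft r (q η)) ∧ LePr r (graft r (q η)) := fun η hη =>
        ih η (hc η).1 <| LePr.comparable (.lim ξ hs) (.lim η (.refl _)) hq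
          (hht.trans_le (hη.trans_eq (hc η).2.symm))
      refine ⟨⟨hq.1, hq.2.1, fun η => ?_, fun η₀ η₁ hη => ?_⟩, ⟨?_, ?_⟩, ?_⟩
      · dsimp only
        split_ifs with h
        · obtain ⟨h1, h2, -⟩ := hup η h
          exact ⟨h1, (h2.ht_eq (hc η).1 h1).symm.trans (hc η).2⟩
        · obtain ⟨h1, h2⟩ := cut_spec hr (not_le.1 h).le
          exact ⟨h1.isCond hr, h2⟩
      · dsimp only
        have hη' : (η₀ : Ordinal.{u}) < η₁ := hη
        by_cases h0 : r.ht ≤ η₀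
        · rw [if_pos h0, if_pos (h0.trans hη'.le)]
          exact (hqc.2.2.2 _ _ hη).graft (hc η₁).1 (h0.trans_eq (hc η₀).2.symm)
        · have c0 := cut_spec hr (not_le.1 h0).le
          rw [if_neg h0]
          by_cases h1 : r.ht ≤ η₁
          · rw [if_pos h1]
            exact c0.1.trans (hup η₁ h1).2.2
          · have c1 := cut_spec hr (not_le.1 h1).le
            rw [if_neg h1]
            exact c0.1.comparable c1.1 hr (by rw [c0.2, c1.2]; exact hη'.le)
      -- The order between limit conditions looks only at a tail, so the changed coordinates below
      -- the height of `r` are harmless.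
      · refine .lim_lim ⟨r.ht, hlt⟩ fun η hη => ?_
        have hη : r.ht ≤ η := hη
        rw [if_pos hη]
        exact (hup η hη).2.1.1
      · refine .lim_lim ⟨r.ht, hlt⟩ fun η hη => ?_
        have hη : r.ht ≤ η := hη
        rw [if_pos hη]
        exact (hup η hη).2.1.2
      · refine .lim ⟨r.ht, hlt⟩ ?_
        rw [if_pos le_rfl]
        exact (hup ⟨r.ht, hlt⟩ le_rfl).2.2

/-- Every condition `q` stronger than `p` is equivalent to one that is purely stronger. -/
theorem Le.exists_lePr (hθ : Cardinal.aleph0 ≤ θ) {p q : PreCond θ} (h : Le p q)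
    (hp : p.IsCond κ) (hq : q.IsCond κ) : ∃ q', q'.IsCond κ ∧ Equiv q q' ∧ LePr p q' := by
  induction h with
  | base ξ => exact ⟨_, hq, .refl hq, .refl _⟩
  | @succ p α ζ n τ w q v ξ h ih =>
    have hc := hq.2.2.2.1
    obtain ⟨r, r1, r2, r3⟩ := ih hp (hc ξ).1
    have hq' : (PreCond.succ α ξ n τ w q v).IsCond κ := hq
    -- The distinguished index does not affect the main order, so it may be moved to the component
    -- that lies above `p`.
    have he : ∀ ζ ζ' : Iio θ.ord,
        Le (PreCond.succ α ζ n τ w q v) (PreCond.succ α ζ' n τ w q v) :=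
      fun _ _ => .succ_succ (fun η => Le.refl _ (hc η).1) fun _ => rfl
    obtain ⟨g1, g2, g3⟩ := graft_spec hθ r1 hq' (.succ (.refl _)) r2
    exact ⟨_, g1, ⟨(he _ _).trans hq' g1 g2.1, g2.2.trans hq' hq (he _ _)⟩, r3.trans g3⟩
  | @lim p γ q ξ h ih =>
    have hc := hq.2.2.1
    obtain ⟨r, r1, r2, r3⟩ := ih hp (hc ξ).1
    obtain ⟨g1, g2, g3⟩ := graft_spec hθ r1 hq (.lim ξ (.refl _)) r2
    exact ⟨_, g1, g2, r3.trans g3⟩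
  | @succ_succ α ζ ζ' n τ w p q v h hs =>
    have h : Le (PreCond.succ α ζ' n τ w p v) (PreCond.succ α ζ n τ w q v) := .succ_succ h hs
    exact ⟨_, hp, ⟨h.symm_of_ht hp hq le_rfl, h⟩, .refl _⟩
  | lim_lim δ h =>
    have h := Le.lim_lim δ h
    exact ⟨_, hp, ⟨h.symm_of_ht hp hq le_rfl, h⟩, .refl _⟩

end PreCond

end Historic

/-! ### Bounds of pure chains and strategic closure -/

namespace Historic

open Set

/-- Fewer than `c` ordinals below a regular cardinal `c` are bounded below `c`. -/
theorem exists_bound_lt_ord {c : Cardinal.{u}} (hc : c.IsRegular) {ι : Type v}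
    (hι : Cardinal.lift.{u} (Cardinal.mk ι) < Cardinal.lift.{v} c) (f : ι → Ordinal.{u})
    (hf : ∀ i, f i < c.ord) : ∃ b < c.ord, ∀ i, f i ≤ b := by
  refine ⟨⨆ i, f i, Ordinal.lift_iSup_lt_of_lt_cof ?_ hf, fun i => le_ciSup ?_ i⟩
  · rwa [Cardinal.lift_ord, hc.lift.cof_ord]
  · exact ⟨c.ord, by rintro _ ⟨i, rfl⟩; exact (hf i).le⟩

namespace PreCond

variable {θ κ : Cardinal.{u}}

/-- A short pure chain of conditions has a purely stronger condition. -/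
theorem exists_lePr_of_chain (hκ : κ.IsRegular) {i : Ordinal.{u}} (hi : i < κ.ord)
    (h0 : i ≠ 0) (p : Iio i → PreCond θ) (hp : ∀ j, (p j).IsCond κ)
    (hchain : ∀ j k, j < k → LePr (p j) (p k)) : ∃ r, r.IsCond κ ∧ ∀ j, LePr (p j) r := by
  have hle : ∀ {j k}, j ≤ k → LePr (p j) (p k) := by
    intro j k h
    rcases h.eq_or_lt with rfl | h
    · exact .refl _
    · exact hchain _ _ h
  by_cases hmax : ∃ k, ∀ j, (p j).ht ≤ (p k).ht
  · obtain ⟨k, hk⟩ := hmax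
    refine ⟨p k, hp k, fun j => ?_⟩
    rcases le_total j k with h | h
    · exact hle h
    · rw [(hle h).eq_of_ht (hp j) (hk j)]
      exact .refl _
  · push Not at hmax
    have hι : Cardinal.lift.{u} (Cardinal.mk (Iio i)) < Cardinal.lift.{u + 1} κ := by
      rw [Cardinal.mk_Iio_ordinal, Cardinal.lift_lift]
      exact Cardinal.lift_lt.2 (Cardinal.lt_ord.1 hi)
    obtain ⟨b, hb, hbp⟩ := exists_bound_lt_ord hκ hι (fun j => (p j).ht)
      fun j => (hp j).ht_lt hκ.aleph0_le
    obtain ⟨γ, ⟨hγ1, hγ2⟩⟩ : ∃ γ, IsLUB (range fun j => (p j).ht) γ :=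
      ⟨_, isLUB_csSup ⟨_, mem_range_self (⟨0, pos_iff_ne_zero.2 h0⟩ : Iio i)⟩
        ⟨b, by rintro _ ⟨j, rfl⟩; exact hbp j⟩⟩
    have hlt : ∀ j, (p j).ht < γ := fun j => by
      obtain ⟨k, hk⟩ := hmax j
      exact hk.trans_le (hγ1 (mem_range_self k))
    have hex : ∀ ξ < γ, ∃ j, ξ < (p j).ht := by
      intro ξ hξ
      by_contra! h
      exact absurd (hγ2 (by rintro _ ⟨j, rfl⟩; exact h j)) (not_le.2 hξ)
    have hγlim : Order.IsSuccLimit γ := by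
      refine ⟨?_, fun ξ hξ => ?_⟩
      · rw [isMin_iff_eq_bot]
        exact (zero_le.trans_lt (hlt ⟨0, pos_iff_ne_zero.2 h0⟩)).ne'
      · obtain ⟨j, hj⟩ := hex ξ hξ.lt
        exact hξ.2 hj (hlt j)
    have : Nonempty (Iio i) := ⟨⟨0, pos_iff_ne_zero.2 h0⟩⟩
    choose! k hk using hex
    -- The `ξ`-th coordinate is cut out of some member of height above `ξ`; different choices cohere
    -- because two members have a common purely stronger one in the chain.
    let r : Iio γ → PreCond θ := fun ξ => cut ξ (p (k ξ))
    have hr : ∀ ξ : Iio γ, LePr (r ξ) (p (k ξ)) ∧ (r ξ).ht = ξ :=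
      fun ξ => cut_spec (hp _) (hk ξ ξ.2).le
    have hrc : ∀ ξ, (r ξ).IsCond κ := fun ξ => (hr ξ).1.isCond (hp _)
    refine ⟨lim γ r, ⟨(hγ2 (by rintro _ ⟨j, rfl⟩; exact hbp j)).trans_lt hb, hγlim,
      fun ξ => ⟨hrc ξ, (hr ξ).2⟩, fun ξ₀ ξ₁ hξ => ?_⟩, fun j => ?_⟩
    · exact LePr.comparable ((hr ξ₀).1.trans (hle (le_max_left _ _)))
        ((hr ξ₁).1.trans (hle (le_max_right _ _))) (hp (max (k ξ₀) (k ξ₁)))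
        (by rw [(hr ξ₀).2, (hr ξ₁).2]; exact hξ.le)
    · refine .lim ⟨(p j).ht, hlt j⟩ ?_
      exact LePr.comparable (hle (le_max_left j (k (p j).ht)))
        ((hr ⟨(p j).ht, hlt j⟩).1.trans (hle (le_max_right _ _))) (hp _) (hr ⟨_, hlt j⟩).2.ge

end PreCond

theorem strategicallyClosed_forcing {θ κ : Cardinal.{u}} (hθ : Cardinal.aleph0 ≤ θ)
    (hκ : κ.IsRegular) : StrategicallyClosed (Forcing θ κ) κ := by
  classical
  -- This asks for more than the rules: the moves must increase purely, so that bounds exist at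
  -- limit rounds.
  let legal : Forcing θ κ → (i : Ordinal.{u}) → (Iic i → OpenDense (Forcing θ κ)) →
      (Iio i → Forcing θ κ) → Forcing θ κ → Prop := fun s i D p q =>
    q ∈ (D ⟨i, self_mem_Iic⟩).carrier ∧ (∀ j, PreCond.LePr (p j).1 q.1) ∧ (i = 0 → s ≤ q)
  refine ⟨fun s i D p => if h : ∃ q, legal s i D p q then h.choose else s,
    fun s D p hp => ?_⟩
  have key : ∀ i, i < κ.ord → legal s i (fun j => D j) (fun j => p j) (p i) := by
    intro i
    induction i using WellFoundedLT.induction with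
    | ind i ih =>
      intro hi
      have hex : ∃ q, legal s i (fun j => D j) (fun j => p j) q := by
        by_cases h0 : i = 0
        · subst h0
          obtain ⟨q, hq, hsq⟩ := (D 0).dense s
          exact ⟨q, hq, fun j => absurd (mem_Iio.1 j.2) (not_lt.2 zero_le), fun _ => hsq⟩
        · obtain ⟨r, hr, hpr⟩ := PreCond.exists_lePr_of_chain hκ hi h0 (fun j => (p j).1)
            (fun j => (p j).2) fun j k hjk =>
              (ih k k.2 ((mem_Iio.1 k.2).trans hi)).2.1 ⟨j, hjk⟩
          obtain ⟨q, hq, hrq⟩ := (D i).dense ⟨r, hr⟩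
          obtain ⟨q', h1, h2, h3⟩ := PreCond.Le.exists_lePr hθ hrq hr q.2
          exact ⟨⟨q', h1⟩, (D i).isOpen q hq ⟨q', h1⟩ h2.1, fun j => (hpr j).trans h3,
            fun h => absurd h h0⟩
      have e := hp i hi
      dsimp only at e
      rw [dif_pos hex] at e
      rw [e]
      exact hex.choose_spec
  exact fun i hi => ⟨(key i hi).2.2, (key i hi).1,
    fun j hj => ((key i hi).2.1 ⟨j, hj⟩).le (p i).2⟩

end Historic

namespace Historic

open Set Cardinal

/-! ### Cardinal arithmetic -/

/-- A code for Boolean terms. -/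
def BoolTerm.code {n : ℕ} : BoolTerm n → ℕ
  | var k => Nat.pair 0 k
  | bot => Nat.pair 1 0
  | top => Nat.pair 2 0
  | neg t => Nat.pair 3 t.code
  | inf s t => Nat.pair 4 (Nat.pair s.code t.code)
  | sup s t => Nat.pair 5 (Nat.pair s.code t.code)

theorem BoolTerm.code_injective {n : ℕ} : Function.Injective (BoolTerm.code (n := n)) := by
  intro s
  induction s with
  | var k => intro t h; cases t <;> simp_all [code, Nat.pair_eq_pair, Fin.ext_iff]
  | bot => intro t h; cases t <;> simp_all [code, Nat.pair_eq_pair]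
  | top => intro t h; cases t <;> simp_all [code, Nat.pair_eq_pair]
  | neg s ih =>
    intro t h
    cases t with
    | neg t => rw [ih (Nat.pair_eq_pair.1 h).2]
    | _ => simp [code, Nat.pair_eq_pair] at h
  | inf s s' ih ih' =>
    intro t h
    cases t with
    | inf t t' =>
      obtain ⟨h1, h2⟩ := Nat.pair_eq_pair.1 (Nat.pair_eq_pair.1 h).2
      rw [ih h1, ih' h2]
    | _ => simp [code, Nat.pair_eq_pair] at h
  | sup s s' ih ih' =>
    intro t h
    cases t with
    | sup t t' =>
      obtain ⟨h1, h2⟩ := Nat.pair_eq_pair.1 (Nat.pair_eq_pair.1 h).2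
      rw [ih h1, ih' h2]
    | _ => simp [code, Nat.pair_eq_pair] at h

instance (n : ℕ) : Countable (BoolTerm n) := BoolTerm.code_injective.countable

theorem mk_Iio_lt_lift {c : Cardinal.{u}} {o : Ordinal.{u}} (h : o < c.ord) :
    #(Iio o) < lift.{u + 1} c := by
  rw [mk_Iio_ordinal]
  exact lift_lt.2 (lt_ord.1 h)

theorem exists_bound_lt_ord_of_mk_lt {c : Cardinal.{u}} (hc : c.IsRegular) {ι : Type (u + 1)}
    (hι : #ι < lift.{u + 1} c) (f : ι → Ordinal.{u}) (hf : ∀ i, f i < c.ord) :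
    ∃ b < c.ord, ∀ i, f i ≤ b :=
  exists_bound_lt_ord hc (by rwa [lift_id'.{u, u + 1}]) f hf

theorem power_le_lift_of_powerlt {κ : Cardinal.{u}} (hpow : κ ^< κ = κ)
    {a b : Cardinal.{u + 1}} (ha : a ≤ lift.{u + 1} κ) (hb : b < lift.{u + 1} κ) :
    a ^ b ≤ lift.{u + 1} κ := by
  obtain ⟨b, hb', rfl⟩ := lt_lift_iff.1 hb
  calc a ^ lift.{u + 1} b ≤ lift.{u + 1} κ ^ lift.{u + 1} b := power_le_power_right ha
    _ = lift.{u + 1} (κ ^ b) := (lift_power _ _).symm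
    _ ≤ lift.{u + 1} κ := lift_le.2 ((le_powerlt κ hb').trans_eq hpow)

theorem exists_large_fiber {X T : Type v} {c : Cardinal.{v}} (hc : ℵ₀ ≤ c) {A : Set X}
    (hA : c < #A) (f : X → T) {S : Set T} (hS : #S ≤ c) (hf : ∀ x ∈ A, f x ∈ S) :
    ∃ t, c < #{x ∈ A | f x = t} := by
  by_contra! h
  have hsub : A ⊆ ⋃ t : S, {x ∈ A | f x = t} := fun x hx =>
    mem_iUnion.2 ⟨⟨f x, hf x hx⟩, hx, rfl⟩
  refine absurd ((mk_le_mk_of_subset hsub).trans (mk_iUnion_le _)) (not_le.2 (hA.trans_le' ?_))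
  exact (mul_le_mul' hS (ciSup_le' fun t : S => h t)).trans_eq (mul_eq_self hc)

theorem mk_setOf_forall_mem_le {X Y : Type v} (t : Set Y) :
    #{r : X → Y | ∀ i, r i ∈ t} ≤ #t ^ #X := by
  rw [power_def]
  refine mk_le_of_injective (f := fun r i => (⟨r.1 i, r.2 i⟩ : t)) fun r s h => ?_
  ext i
  exact congrArg Subtype.val (congrFun h i)

/-- Transfinite dependent choice. -/
theorem exists_rec_seq {C : Type v} [Nonempty C] (l : Ordinal.{u})
    (R : (ξ : Ordinal.{u}) → (Iio ξ → C) → C → Prop)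
    (h : ∀ ξ < l, ∀ g, ∃ c, R ξ g c) :
    ∃ g : Ordinal.{u} → C, ∀ ξ < l, R ξ (fun ζ => g ζ) (g ξ) := by
  choose! F hF using h
  let g : Ordinal.{u} → C := WellFounded.fix wellFounded_lt
    fun ξ g => F ξ fun ζ => g ζ (mem_Iio.1 ζ.2)
  refine ⟨g, fun ξ hξ => ?_⟩
  have e : g ξ = F ξ fun ζ => g ζ := WellFounded.fix_eq _ _ _
  rw [e]
  exact hF ξ hξ _

theorem exists_enum {κ : Cardinal.{u}} {K : Ordinal.{u}} {s : Set Ordinal.{u}} (hs : s ⊆ Iio K)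
    (hc : #s < lift.{u + 1} κ) :
    ∃ o < κ.ord, ∃ e : Ordinal.{u} → Ordinal.{u}, StrictMono e ∧ e '' Iio o = s := by
  -- Adding everything from `K` on makes the set unbounded, so `enumOrd` is increasing on all
  -- ordinals; the position of `K` is then the order type of `s`.
  have hS : ¬BddAbove (s ∪ Ici K) := by
    rintro ⟨b, hb⟩
    exact absurd (hb (.inr (le_max_left K (b + 1))))
      (not_le.2 ((Order.lt_succ b).trans_le (le_max_right _ _)))
  have he := Ordinal.enumOrd_strictMono hS
  have hr := Ordinal.range_enumOrd hS
  obtain ⟨o, ho⟩ : K ∈ range (Ordinal.enumOrd (s ∪ Ici K)) := by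
    rw [hr]; exact .inr self_mem_Ici
  have himg : Ordinal.enumOrd (s ∪ Ici K) '' Iio o = s := by
    apply Subset.antisymm
    · rintro _ ⟨i, hi, rfl⟩
      have h1 := he hi
      rw [ho] at h1
      have h2 : Ordinal.enumOrd (s ∪ Ici K) i ∈ s ∪ Ici K := hr.subset (mem_range_self i)
      exact h2.resolve_right (not_le.2 h1)
    · intro x hx
      obtain ⟨i, rfl⟩ : x ∈ range (Ordinal.enumOrd (s ∪ Ici K)) := by
        rw [hr]; exact .inl hx
      exact ⟨i, he.lt_iff_lt.1 ((hs hx).trans_eq ho.symm), rfl⟩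
  refine ⟨o, ?_, _, he, himg⟩
  rw [← himg, mk_image_eq he.injective, mk_Iio_ordinal, lift_lt] at hc
  exact lt_ord.2 hc

namespace PreCond

variable {θ κ : Cardinal.{u}}

theorem IsCond.mk_supp_lt (hκ : κ.IsRegular) (hθκ : θ < κ) {p : PreCond θ} (hp : p.IsCond κ) :
    #p.supp < lift.{u + 1} κ := by
  have hr : (lift.{u + 1} κ).IsRegular := hκ.lift
  induction p with
  | base ξ =>
    rw [supp, mk_singleton]
    exact one_lt_aleph0.trans_le hr.aleph0_le
  | succ α ζ n τ w p v ih =>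
    refine (card_iUnion_lt_iff_forall_of_isRegular hr (mk_Iio_lt_lift ?_)).2
      fun ξ => ih ξ (hp.2.2.2.1 ξ).1
    exact ord_lt_ord.2 hθκ
  | lim γ p ih =>
    exact (card_iUnion_lt_iff_forall_of_isRegular hr (mk_Iio_lt_lift hp.1)).2
      fun ξ => ih ξ (hp.2.2.1 ξ).1

/-! ### Conditions of the same isomorphism type -/

/-- The function `h^p`, transferred to the order type `o` of `u^p` by its enumeration `e`. -/
def histCode (p : PreCond θ) (o : Ordinal.{u}) (e : Ordinal.{u} → Ordinal.{u}) :
    Set (Ordinal.{u} × Ordinal.{u} × Ordinal.{u}) :=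
  {x | x.1 < o ∧ p.Hist (e x.1) x.2.1 x.2.2}

/-- The function `g^p`, transferred to the order type `o` of `u^p` by its enumeration `e`. -/
def gistCode (p : PreCond θ) (o : Ordinal.{u}) (e : Ordinal.{u} → Ordinal.{u}) :
    Set (Ordinal.{u} × Ordinal.{u} × Bool × (Σ n, BoolTerm n)) :=
  {x | x.1 < o ∧ p.Gist (e x.1) x.2.1 x.2.2.1 x.2.2.2}

/-- Equal codes say that `h` and `g` agree along the order isomorphism of the supports, so rigidity
applies. -/
theorem eq_map_of_code_eq (hθ : ℵ₀ ≤ θ) {p q : PreCond θ} (hp : p.IsCond κ) (hq : q.IsCond κ)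
    (hht : p.ht = q.ht) {o : Ordinal.{u}} {e e₁ : Ordinal.{u} → Ordinal.{u}}
    (he : StrictMono e) (he' : StrictMono e₁) (hs : e '' Iio o = p.supp)
    (hs' : e₁ '' Iio o = q.supp) (hh : p.histCode o e = q.histCode o e₁)
    (hg : p.gistCode o e = q.gistCode o e₁) :
    StrictMonoOn (e₁ ∘ Function.invFun e) p.supp ∧ q = p.map (e₁ ∘ Function.invFun e) := by
  have hl : ∀ i, Function.invFun e (e i) = i := Function.leftInverse_invFun he.injective
  have hm : StrictMonoOn (e₁ ∘ Function.invFun e) p.supp := by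
    rw [← hs]
    rintro _ ⟨i, -, rfl⟩ _ ⟨j, -, rfl⟩ hij
    simp only [Function.comp_apply, hl]
    exact he' (he.lt_iff_lt.1 hij)
  refine ⟨hm, eq_map_of_agree hθ hp hq hht hm ?_ ?_⟩
  · rw [← hs, ← hs', image_image]
    simp only [Function.comp_apply, hl]
  · rw [← hs]
    rintro _ ⟨i, hi, rfl⟩ β -
    rw [Function.comp_apply, hl]
    refine ⟨fun y => ?_, fun l t => ?_⟩
    · have := Set.ext_iff.1 hh (i, β, y)
      simpa [histCode, mem_Iio.1 hi] using this
    · have := Set.ext_iff.1 hg (i, β, l, t)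
      simpa [gistCode, mem_Iio.1 hi] using this

theorem eq_of_code_eq (hθ : ℵ₀ ≤ θ) {p q : PreCond θ} (hp : p.IsCond κ) (hq : q.IsCond κ)
    (hht : p.ht = q.ht) {o : Ordinal.{u}} {e e₁ : Ordinal.{u} → Ordinal.{u}}
    (he : StrictMono e) (he' : StrictMono e₁) (hs : e '' Iio o = p.supp)
    (hs' : e₁ '' Iio o = q.supp) (hh : p.histCode o e = q.histCode o e₁)
    (hg : p.gistCode o e = q.gistCode o e₁) (hee : EqOn e e₁ (Iio o)) : p = q := by
  rw [(eq_map_of_code_eq hθ hp hq hht he he' hs hs' hh hg).2,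
    map_congr (H := id) hθ hp, map_id]
  rw [← hs]
  rintro _ ⟨i, hi, rfl⟩
  have hl : Function.invFun e (e i) = i := Function.leftInverse_invFun he.injective i
  rw [Function.comp_apply, hl, hee hi, id_eq]

/-- Codes are subsets of a product of fewer than `κ` triples depending only on `o` and `α`, and such
a set has at most `κ` subsets. -/
theorem mk_histCode_le (hκ : κ.IsRegular) (hθ : ℵ₀ ≤ θ) (hθκ : θ < κ) (hpow : κ ^< κ = κ)
    {o α : Ordinal.{u}} (ho : o < κ.ord) (hα : α < κ.ord) :
    ∃ S : Set (Set (Ordinal.{u} × Ordinal.{u} × Ordinal.{u})), #S ≤ lift.{u + 1} κ ∧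
      ∀ (p : PreCond θ) (e : Ordinal.{u} → Ordinal.{u}), p.IsCond κ → p.ht = α →
        p.histCode o e ∈ S := by
  have h0 : ℵ₀ ≤ lift.{u + 1} κ := aleph0_le_lift.2 hκ.aleph0_le
  refine ⟨𝒫 (Iio o ×ˢ Iio α ×ˢ Iio (θ.ord + 2)), ?_, ?_⟩
  · rw [mk_powerset]
    refine power_le_lift_of_powerlt hpow (((natCast_lt_aleph0 (n := 2))).le.trans h0) ?_
    rw [mk_setProd, mk_setProd]
    refine mul_lt_of_lt h0 (mk_Iio_lt_lift ho) (mul_lt_of_lt h0 (mk_Iio_lt_lift hα)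
      (mk_Iio_lt_lift ?_))
    have hl := isSuccLimit_ord hκ.aleph0_le
    have := hl.succ_lt (hl.succ_lt (ord_lt_ord.2 hθκ))
    rwa [← one_add_one_eq_two, ← add_assoc]
  · rintro p e hp rfl ⟨i, β, y⟩ ⟨hi, h⟩
    have := h.mem hθ hp
    exact ⟨hi, this.2.1, this.2.2⟩

theorem mk_gistCode_le (hκ : κ.IsRegular) (hθ : ℵ₀ ≤ θ) (hθκ : θ < κ) (hpow : κ ^< κ = κ)
    {o α : Ordinal.{u}} (ho : o < κ.ord) (hα : α < κ.ord) :
    ∃ S : Set (Set (Ordinal.{u} × Ordinal.{u} × Bool × (Σ n, BoolTerm n))),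
      #S ≤ lift.{u + 1} κ ∧
      ∀ (p : PreCond θ) (e : Ordinal.{u} → Ordinal.{u}), p.IsCond κ → p.ht = α →
        p.gistCode o e ∈ S := by
  have h0 : ℵ₀ ≤ lift.{u + 1} κ := aleph0_le_lift.2 hκ.aleph0_le
  refine ⟨𝒫 (Iio o ×ˢ Iio α ×ˢ Set.univ), ?_, ?_⟩
  · rw [mk_powerset]
    refine power_le_lift_of_powerlt hpow (((natCast_lt_aleph0 (n := 2))).le.trans h0) ?_
    rw [mk_setProd, mk_congr (Equiv.Set.prod (Iio α) Set.univ), mk_prod, lift_uzero]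
    refine mul_lt_of_lt h0 (mk_Iio_lt_lift ho) (mul_lt_of_lt h0 (mk_Iio_lt_lift hα) ?_)
    refine lt_of_le_of_lt (b := ℵ₀) ?_ ?_
    · rw [lift_le_aleph0]
      exact mk_le_aleph0
    · exact aleph0_lt_lift.2 (hθ.trans_lt hθκ)
  · rintro p e hp rfl ⟨i, β, l, t⟩ ⟨hi, h⟩
    exact ⟨hi, (h.mem hp).2, mem_univ _⟩

/-- A `Δ`-system of `θ` isomorphic conditions has a common upper bound. -/
theorem exists_isCond_of_deltaSystem (hθ : ℵ₀ ≤ θ) {p : Iio θ.ord → PreCond θ}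
    {α o η β : Ordinal.{u}} {e : Iio θ.ord → Ordinal.{u} → Ordinal.{u}}
    (hα : α < κ.ord) (hη : η < o) (hηκ : η < κ.ord)
    (hp : ∀ ξ, (p ξ).IsCond κ) (hht : ∀ ξ, (p ξ).ht = α)
    (he : ∀ ξ, StrictMono (e ξ)) (hs : ∀ ξ, e ξ '' Iio o = (p ξ).supp)
    (hh : ∀ ξ ζ, (p ξ).histCode o (e ξ) = (p ζ).histCode o (e ζ))
    (hg : ∀ ξ ζ, (p ξ).gistCode o (e ξ) = (p ζ).gistCode o (e ζ))
    (hee : ∀ ξ ζ, EqOn (e ξ) (e ζ) (Iio η)) (hβ : ∀ ξ, ∀ i < η, e ξ i ≤ β)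
    (hβη : ∀ ξ, β < e ξ η)
    (hsep : ∀ ξ ζ, ξ < ζ → ∃ b < e ζ η, ∀ x ∈ (p ξ).supp, x ≤ b) :
    ∃ r : PreCond θ, r.IsCond κ ∧ ∀ ξ, Le (p ξ) r := by
  obtain ⟨a, -, -⟩ := exists_lt_Iio_ord hθ
  let w := e a '' Iio η
  have hw : ∀ ξ, w = e ξ '' Iio η := fun ξ => image_congr (hee a ξ)
  have hwp : ∀ ξ, w ⊆ (p ξ).supp := fun ξ => by
    rw [hw ξ, ← hs ξ]
    exact image_mono (Iio_subset_Iio hη.le)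
  have hd : ∀ ξ, ∀ x ∈ (p ξ).supp \ w, e ξ η ≤ x := by
    rintro ξ x ⟨hx, hxw⟩
    rw [← hs ξ] at hx
    obtain ⟨i, -, rfl⟩ := hx
    refine (he ξ).monotone (not_lt.1 fun hi => hxw ?_)
    rw [hw ξ]
    exact ⟨i, hi, rfl⟩
  have hne : ∀ ξ, e ξ η ∈ (p ξ).supp \ w := fun ξ => by
    refine ⟨hs ξ ▸ ⟨η, hη, rfl⟩, ?_⟩
    rw [hw ξ]
    rintro ⟨i, hi, h⟩
    exact (mem_Iio.1 hi).ne ((he ξ).injective h)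
  have hwβ : ∀ x ∈ w, x ≤ β := by
    rintro _ ⟨i, hi, rfl⟩
    exact hβ a i hi
  -- With `n* = 0` the requirements on the finite sets are vacuous.
  let v : Fin 0 ↪o Ordinal.{u} := OrderEmbedding.ofIsEmpty
  have hv : range v = ∅ := range_eq_empty _
  refine ⟨succ α a 0 .top w p fun _ => v, ⟨hα, (hwp a).trans (hp a).supp_subset, ?_,
    fun ξ => ⟨hp ξ, hht ξ, by simp [hv], ⟨_, hne ξ⟩, ?_⟩, fun ξ ζ hξ => ⟨?_, ?_, ?_⟩⟩,
    fun ξ => .succ ξ (Le.refl _ (hp ξ))⟩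
  · exact mk_image_le.trans_lt (mk_Iio_lt_lift hηκ)
  -- The bound `β` also covers an empty root, whose supremum is `0`.
  · exact (csSup_le' hwβ).trans_lt ((hβη ξ).trans_le (le_csInf ⟨_, hne ξ⟩ (hd ξ)))
  · obtain ⟨b, hb, hpb⟩ := hsep ξ ζ hξ
    apply Subset.antisymm
    · rintro x ⟨h1, h2⟩
      by_contra hxw
      exact absurd (hpb x h1) (not_le.2 (hb.trans_le (hd ζ x ⟨h2, hxw⟩)))
    · exact fun x hx => ⟨hwp ξ hx, hwp ζ hx⟩
  · obtain ⟨b, hb, hpb⟩ := hsep ξ ζ hξ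
    exact (csSup_le' fun x hx => hpb x hx.1).trans_lt (hb.trans_le (le_csInf ⟨_, hne ζ⟩ (hd ζ)))
  · obtain ⟨hm, hmap⟩ := eq_map_of_code_eq hθ (hp ξ) (hp ζ) ((hht ξ).trans (hht ζ).symm)
      (he ξ) (he ζ) (hs ξ) (hs ζ) (hh ξ ζ) (hg ξ ζ)
    have := isoOver_map (α := α) (w := w) (v := v) (v' := v) hθ (hp ξ)
      (strictMono_id.strictMonoOn _) hm ?_ ?_
    · rw [map_id, ← hmap] at this
      exact this
    · intro j _ hjw
      rw [hw ξ] at hjw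
      obtain ⟨i, hi, h⟩ := hjw
      have hl : Function.invFun (e ξ) (e ξ i) = i :=
        Function.leftInverse_invFun (he ξ).injective i
      rw [id_eq] at h
      rw [← h, Function.comp_apply, hl, h, ← h, hee ζ ξ hi]
      rfl
    · simp [hv]

end PreCond

end Historic

/-! ### The chain condition -/

namespace Historic

open Set Cardinal

namespace PreCond

variable {θ κ : Cardinal.{u}}

/-- Among more than `κ` conditions of the same isomorphism type, more than `κ` many agree on an
initial segment of their supports, while the next element is unbounded in `κ⁺`. -/
theorem exists_root (hκ : κ.IsRegular) (hpow : κ ^< κ = κ) {B : Set (PreCond θ)}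
    (hB : lift.{u + 1} κ < #B) {o : Ordinal.{u}} (ho : o < κ.ord)
    {e : PreCond θ → Ordinal.{u} → Ordinal.{u}}
    (heK : ∀ p ∈ B, ∀ i < o, e p i < (Order.succ κ).ord)
    (hinj : ∀ p ∈ B, ∀ q ∈ B, EqOn (e p) (e q) (Iio o) → p = q) :
    ∃ C ⊆ B, ∃ η < o, ∃ β < (Order.succ κ).ord,
      (∀ p ∈ C, ∀ q ∈ C, EqOn (e p) (e q) (Iio η)) ∧ (∀ p ∈ C, ∀ i < η, e p i ≤ β) ∧
      ∀ b < (Order.succ κ).ord, ∃ p ∈ C, b < e p η := by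
  have h0 : ℵ₀ ≤ lift.{u + 1} κ := aleph0_le_lift.2 hκ.aleph0_le
  have hK : (Order.succ κ).IsRegular := isRegular_succ hκ.aleph0_le
  have hκK : κ.ord < (Order.succ κ).ord := ord_lt_ord.2 (Order.lt_succ κ)
  -- The implication makes `o` itself a member, so a least `η` exists; it equals `o` when every
  -- position is bounded.
  let P : Ordinal.{u} → Prop := fun η => η < o →
    ∀ b < (Order.succ κ).ord, ∃ p ∈ B, b < e p η
  obtain ⟨η, hPη, hmin⟩ := WellFounded.has_min (wellFounded_lt (α := Ordinal.{u})) {η | P η}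
    ⟨o, fun h => absurd h (lt_irrefl o)⟩
  have hηo : η ≤ o := not_lt.1 (hmin o fun h => absurd h (lt_irrefl o))
  have hηκ : η < κ.ord := hηo.trans_lt ho
  have hbd : ∀ i : Iio η, ∃ b < (Order.succ κ).ord, ∀ p ∈ B, e p i ≤ b := by
    intro i
    by_contra! h
    exact hmin i (fun _ => h) i.2
  choose b hb hbB using hbd
  obtain ⟨β, hβ, hβb⟩ := exists_bound_lt_ord_of_mk_lt hK (mk_Iio_lt_lift (hηκ.trans hκK)) b hb
  have hβB : ∀ p ∈ B, ∀ i < η, e p i ≤ β := fun p hp i hi =>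
    (hbB ⟨i, hi⟩ p hp).trans (hβb ⟨i, hi⟩)
  let ρ : PreCond θ → Iio η → Ordinal.{u} := fun p i => e p i
  let S : Set (Iio η → Ordinal.{u}) := {r | ∀ i, r i ∈ Iio (β + 1)}
  have hρS : ∀ p ∈ B, ρ p ∈ S := fun p hp i => Order.lt_succ_iff.2 (hβB p hp i i.2)
  have hS : #S ≤ lift.{u + 1} κ := by
    refine (mk_setOf_forall_mem_le _).trans
      (power_le_lift_of_powerlt hpow ?_ (mk_Iio_lt_lift hηκ))
    have := mk_Iio_lt_lift ((isSuccLimit_ord hK.aleph0_le).succ_lt hβ)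
    rwa [lift_succ, Order.lt_succ_iff] at this
  have hηo : η < o := by
    -- Were all positions bounded, there would be at most `κ` enumerations, and more than `κ`
    -- conditions would share one, against `hinj`.
    refine hηo.lt_of_ne fun h => ?_
    subst h
    obtain ⟨t, ht⟩ := exists_large_fiber h0 hB ρ hS hρS
    have : Subsingleton {p ∈ B | ρ p = t} := by
      refine ⟨fun ⟨p, hp, hpt⟩ ⟨q, hq, hqt⟩ => Subtype.ext (hinj p hp q hq fun i hi => ?_)⟩
      exact congrFun (hpt.trans hqt.symm) ⟨i, hi⟩
    exact absurd (ht.trans_le (le_one_iff_subsingleton.2 this))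
      (not_lt.2 (one_lt_aleph0.le.trans h0))
  -- Otherwise each of the at most `κ` restrictions has a bound below `κ⁺`, and by regularity so
  -- does position `η` altogether.
  obtain ⟨t, ht⟩ : ∃ t, ∀ b < (Order.succ κ).ord, ∃ p ∈ B, ρ p = t ∧ b < e p η := by
    by_contra! h
    choose c hc hcB using h
    obtain ⟨d, hd, hcd⟩ := exists_bound_lt_ord_of_mk_lt (ι := S) hK
      (hS.trans_lt (lift_lt.2 (Order.lt_succ κ))) (fun t => c t) fun t => hc t
    obtain ⟨p, hp, hpd⟩ := hPη hηo d hd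
    exact absurd hpd (not_lt.2 ((hcB _ p hp rfl).trans (hcd ⟨ρ p, hρS p hp⟩)))
  refine ⟨{p ∈ B | ρ p = t}, fun p hp => hp.1, η, hηo, β, hβ, ?_, fun p hp => hβB p hp.1, ?_⟩
  · exact fun p hp q hq i hi => congrFun (hp.2.trans hq.2.symm) ⟨i, hi⟩
  · intro b hb
    obtain ⟨p, hp, h1, h2⟩ := ht b hb
    exact ⟨p, ⟨hp, h1⟩, h2⟩

theorem exists_compatible_of_code_eq (hθ : ℵ₀ ≤ θ) (hκ : κ.IsRegular)
    (hθκ : θ < κ) (hpow : κ ^< κ = κ) {B : Set (PreCond θ)} (hB : lift.{u + 1} κ < #B)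
    (hcond : ∀ p ∈ B, p.IsCond κ) {o α : Ordinal.{u}} (ho : o < κ.ord) (hα : α < κ.ord)
    {e : PreCond θ → Ordinal.{u} → Ordinal.{u}} (he : ∀ p ∈ B, StrictMono (e p))
    (hs : ∀ p ∈ B, e p '' Iio o = p.supp) (hht : ∀ p ∈ B, p.ht = α) {c c'}
    (hh : ∀ p ∈ B, p.histCode o (e p) = c) (hg : ∀ p ∈ B, p.gistCode o (e p) = c') :
    ∃ p ∈ B, ∃ q ∈ B, p ≠ q ∧ ∃ r : PreCond θ, r.IsCond κ ∧ Le p r ∧ Le q r := by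
  have hK : (Order.succ κ).IsRegular := isRegular_succ hκ.aleph0_le
  obtain ⟨C, hCB, η, hη, β, hβ, hCe, hCβ, hC⟩ := exists_root hκ hpow hB ho
    (fun p hp i hi => (hcond p hp).supp_subset (hs p hp ▸ mem_image_of_mem _ hi))
    (fun p hp q hq h => eq_of_code_eq hθ (hcond p hp) (hcond q hq)
      ((hht p hp).trans (hht q hq).symm) (he p hp) (he q hq) (hs p hp) (hs q hq)
      ((hh p hp).trans (hh q hq).symm) ((hg p hp).trans (hg q hq).symm) h)
  obtain ⟨p₀, hp₀, -⟩ := hC β hβ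
  have : Nonempty C := ⟨⟨p₀, hp₀⟩⟩
  have hlt : κ.ord < (Order.succ κ).ord := ord_lt_ord.2 (Order.lt_succ κ)
  obtain ⟨g, hgR⟩ := exists_rec_seq (C := C) θ.ord
    -- The first point past the root must exceed `β` and strictly exceed a bound of all earlier
    -- supports, as required for suprema below infima.
    (fun ξ f p => β < e p η ∧ ∃ b < e p η, ∀ ζ, ∀ x ∈ (f ζ).1.supp, x ≤ b) <| by
      intro ξ hξ f
      have hr : (lift.{u + 1} (Order.succ κ)).IsRegular := hK.lift
      have hcard : #(⋃ ζ, (f ζ).1.supp : Set Ordinal.{u}) < lift.{u + 1} (Order.succ κ) := by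
        refine (card_iUnion_lt_iff_forall_of_isRegular hr (mk_Iio_lt_lift ?_)).2 fun ζ => ?_
        · exact hξ.trans ((ord_lt_ord.2 hθκ).trans hlt)
        · exact ((hcond _ (hCB (f ζ).2)).mk_supp_lt hκ hθκ).trans
            (lift_lt.2 (Order.lt_succ κ))
      obtain ⟨b, hb, hbf⟩ := exists_bound_lt_ord_of_mk_lt hK hcard (fun x => x) fun x => by
        obtain ⟨ζ, hx⟩ := mem_iUnion.1 x.2
        exact (hcond _ (hCB (f ζ).2)).supp_subset hx
      obtain ⟨p, hp, hbp⟩ := hC (max β b) (max_lt hβ hb)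
      exact ⟨⟨p, hp⟩, (le_max_left _ _).trans_lt hbp, b, (le_max_right _ _).trans_lt hbp,
        fun ζ x hx => hbf ⟨x, mem_iUnion.2 ⟨ζ, hx⟩⟩⟩
  have hgB : ∀ ξ, (g ξ).1 ∈ B := fun ξ => hCB (g ξ).2
  have hsep : ∀ ξ ζ : Iio θ.ord, ξ < ζ → ∃ b < e (g ζ) η, ∀ x ∈ (g ξ).1.supp, x ≤ b := by
    intro ξ ζ hξ
    obtain ⟨-, b, hb, h⟩ := hgR ζ ζ.2
    exact ⟨b, hb, h ⟨ξ, hξ⟩⟩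
  obtain ⟨r, hr, hgr⟩ := exists_isCond_of_deltaSystem hθ (p := fun ξ => (g ξ).1)
    (e := fun ξ => e (g ξ)) (β := β) hα hη (hη.trans ho) (fun ξ => hcond _ (hgB ξ))
    (fun ξ => hht _ (hgB ξ)) (fun ξ => he _ (hgB ξ)) (fun ξ => hs _ (hgB ξ))
    (fun ξ ζ => (hh _ (hgB ξ)).trans (hh _ (hgB ζ)).symm)
    (fun ξ ζ => (hg _ (hgB ξ)).trans (hg _ (hgB ζ)).symm)
    (fun ξ ζ => hCe _ (g ξ).2 _ (g ζ).2) (fun ξ => hCβ _ (g ξ).2)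
    (fun ξ => (hgR ξ ξ.2).1) hsep
  obtain ⟨a, b, hab⟩ := exists_lt_Iio_ord hθ
  refine ⟨_, hgB a, _, hgB b, fun h => ?_, r, hr, hgr a, hgr b⟩
  obtain ⟨d, hd, hdx⟩ := hsep a b hab
  rw [h] at hdx
  exact absurd (hdx _ (hs _ (hgB b) ▸ mem_image_of_mem _ hη)) (not_le.2 hd)

end PreCond

/-- The `κ⁺`-chain condition. -/
theorem chainCondition_forcing {θ κ : Cardinal.{u}} (hθ : ℵ₀ ≤ θ) (hκ : κ.IsRegular)
    (hθκ : θ < κ) (hpow : κ ^< κ = κ) :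
    ChainCondition (Forcing θ κ) (lift.{u + 1} (Order.succ κ)) := by
  intro A hA
  by_contra hlarge
  rw [lift_succ, Order.lt_succ_iff, not_le] at hlarge
  have h0 : ℵ₀ ≤ lift.{u + 1} κ := aleph0_le_lift.2 hκ.aleph0_le
  have hIκ : #(Iio κ.ord) ≤ lift.{u + 1} κ := by rw [mk_Iio_ordinal, card_ord]
  rw [← mk_image_eq (f := fun p : Forcing θ κ => p.1) Subtype.val_injective] at hlarge
  set B : Set (PreCond θ) := (fun p : Forcing θ κ => p.1) '' A with hBdef
  have hBc : ∀ p ∈ B, p.IsCond κ := by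
    rintro _ ⟨p, -, rfl⟩
    exact p.2
  choose! o ho e he hs using fun (p : PreCond θ) (hp : p.IsCond κ) =>
    exists_enum hp.supp_subset (hp.mk_supp_lt hκ hθκ)
  obtain ⟨o', hB₁⟩ := exists_large_fiber h0 hlarge o hIκ fun p hp => ho p (hBc p hp)
  obtain ⟨α, hB₂⟩ := exists_large_fiber h0 hB₁ PreCond.ht hIκ
    fun p hp => (hBc p hp.1).ht_lt hκ.aleph0_le
  obtain ⟨p₀, hp₀⟩ : {p ∈ {p ∈ B | o p = o'} | p.ht = α}.Nonempty := by
    by_contra h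
    rw [not_nonempty_iff_eq_empty] at h
    rw [h, mk_eq_zero] at hB₂
    exact not_lt_zero hB₂
  have ho' : o' < κ.ord := hp₀.1.2 ▸ ho p₀ (hBc _ hp₀.1.1)
  have hα : α < κ.ord := hp₀.2 ▸ (hBc _ hp₀.1.1).ht_lt hκ.aleph0_le
  obtain ⟨S₁, hS₁, hmem₁⟩ := PreCond.mk_histCode_le hκ hθ hθκ hpow ho' hα
  obtain ⟨c, hB₃⟩ := exists_large_fiber h0 hB₂ (fun p => p.histCode o' (e p)) hS₁
    fun p hp => hmem₁ _ _ (hBc p hp.1.1) hp.2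
  obtain ⟨S₂, hS₂, hmem₂⟩ := PreCond.mk_gistCode_le hκ hθ hθκ hpow ho' hα
  obtain ⟨c', hB₄⟩ := exists_large_fiber h0 hB₃ (fun p => p.gistCode o' (e p)) hS₂
    fun p hp => hmem₂ _ _ (hBc p hp.1.1.1) hp.1.2
  obtain ⟨p, hp, q, hq, hne, r, hr, hpr, hqr⟩ := PreCond.exists_compatible_of_code_eq hθ hκ hθκ
    hpow hB₄ (fun p hp => hBc p hp.1.1.1.1) ho' hα (fun p hp => he p (hBc p hp.1.1.1.1))
    (fun p hp => hp.1.1.1.2 ▸ hs p (hBc p hp.1.1.1.1)) (fun p hp => hp.1.1.2)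
    (fun p hp => hp.1.2) (fun p hp => hp.2)
  obtain ⟨p, hpA, rfl⟩ := hp.1.1.1.1
  obtain ⟨q, hqA, rfl⟩ := hq.1.1.1.1
  exact hA p hpA q hqA (fun h => hne (congrArg _ h)) ⟨⟨r, hr⟩, hpr, hqr⟩

end Historic

theorem proposition3p3 (θ κ : Cardinal.{u}) (hθ : θ.IsRegular) (hκ : κ.IsRegular) (hθκ : θ < κ)
    (hpow : κ ^< κ = κ) :
    Historic.StrategicallyClosed (Historic.Forcing θ κ) κ ∧
      Historic.ChainCondition (Historic.Forcing θ κ)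
        (Cardinal.lift.{u + 1} (Order.succ κ)) :=
  ⟨Historic.strategicallyClosed_forcing hθ.aleph0_le hκ,
    Historic.chainCondition_forcing hθ.aleph0_le hκ hθκ hpow⟩
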